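/- Let $n\ge 1$ and $k\ge 1$ be integers. Let $$\Pi_{C_n}=\{x\in\mathbb R^n : 0\le 2x_1\le 1,\ 0\le x_{i+1}-x_i\le 1 \text{ for } 1\le i<n\}.$$ Define the half-open type C hypersimplex by $\Delta'_{C_n,1}=\{x\in\Pi_{C_n}: 0\le 2x_n\le 1\}$ and, for $k\ge 2$, $\Delta'_{C_n,k}=\{x\in\Pi_{C_n}: k-1<2x_n\le k\}$ (which is empty for $k\ge 2n$). For $P=\Delta'_{C_n,k}$ there is a unique polynomial $L_P\in\mathbb Q[r]$ such that $L_P(r)=|rP\cap\tfrac12\mathbb Z^n|<\infty$ for all integers $r\ge 1$. The $h^*$-polynomial $h^*_P(t)$ of $P$ with respect to the lattice $\tfrac12\mathbb Z^n$ is defined by $$\sum_{r\ge 0}L_P(r)\,t^r=\frac{h^*_P(t)}{(1-t)^{d+1}},\qquad d=\dim P,$$ where the term $r=0$ is the value at $0$ of the polynomial $L_P$ (and $h^*_\emptyset=0$). Let $\mathfrak B_n$ be the group of signed permutations, i.e. permutations $w$ of $\{-n,\dots,-1,1,\dots,n\}$ with $w(-i)=-w(i)$ for all $i$; write $w_i=w(i)$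 and $w_0=0$. Let $X_n=\{w\in\mathfrak B_n: w^{-1}(1)>0\}$, and for $w\in\mathfrak B_n$ let $$\mathrm{des}_B(w)=|\{0\le i\le n-1: w_i>w_{i+1}\}|,$$ $$\mathrm{fexc}(w)=2\,|\{1\le i\le n: w_i>i\}|+|\{1\le i\le n: w_i<0\}|.$$ Then $h^*_{\Delta'_{C_n,k}}(t)$ exists as a polynomial and $$h^*_{\Delta'_{C_n,k}}(t)=\sum_{\substack{w\in X_n\\ \mathrm{fexc}(w)=k-1}}t^{\mathrm{des}_B(w)}.$$ -/

import Mathlib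

open scoped Pointwise

/-! ### Ehrhart theory -/

/-- The Ehrhart polynomial of `P` with respect to the lattice `Λ`: the polynomial whose value at
every positive integer `r` is the (finite) number of points of `Λ` in the dilate `r P`.
The value at `r = 0` is the one forced by polynomiality. For a (nonempty) lattice polytope it is `1`;
for a half-open polytope it need not be the number of lattice points of the degenerate set `0 P`. -/
def IsEhrhartPolynomial {n : ℕ} (Λ : AddSubgroup (Fin n → ℝ)) (P : Set (Fin n → ℝ))
    (L : Polynomial ℚ) : Prop :=
  ∀ r : ℕ, 1 ≤ r →
    (((r : ℝ) • P) ∩ (Λ : Set (Fin n → ℝ))).Finite ∧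
      L.eval (r : ℚ) = ((((r : ℝ) • P) ∩ (Λ : Set (Fin n → ℝ))).ncard : ℚ)

/-- The dimension of a subset of `ℝⁿ`, that is, the dimension of its affine span. -/
noncomputable def setDim {n : ℕ} (P : Set (Fin n → ℝ)) : ℕ :=
  Module.finrank ℝ (vectorSpan ℝ P)

/-- `h` is the `h^*`-polynomial of `P` with respect to `Λ`:
`∑_{r ≥ 0} L_P(r) t^r = h(t) / (1 - t)^(d + 1)` as formal power series, with `d = dim P`
and `L_P` the Ehrhart polynomial (whose existence is part of the assertion). -/
def IsHStarPolynomial {n : ℕ} (Λ : AddSubgroup (Fin n → ℝ)) (P : Set (Fin n → ℝ))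
    (h : Polynomial ℚ) : Prop :=
  ∃ L : Polynomial ℚ, IsEhrhartPolynomial Λ P L ∧
    PowerSeries.mk (fun r : ℕ => L.eval (r : ℚ)) * (1 - PowerSeries.X) ^ (setDim P + 1)
      = (h : PowerSeries ℚ)

/-- The Ehrhart polynomial is unique. -/
theorem IsEhrhartPolynomial.unique {n : ℕ} {Λ : AddSubgroup (Fin n → ℝ)} {P : Set (Fin n → ℝ)}
    {L L' : Polynomial ℚ} (hL : IsEhrhartPolynomial Λ P L) (hL' : IsEhrhartPolynomial Λ P L') :
    L = L' := by
  refine Polynomial.eq_of_infinite_eval_eq L L' ?_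
  refine Set.infinite_of_injective_forall_mem (f := fun r : ℕ => ((r + 1 : ℕ) : ℚ)) ?_ ?_
  · intro a b hab
    have h : a + 1 = b + 1 := Nat.cast_injective (R := ℚ) hab
    omega
  · intro r
    exact ((hL (r + 1) (by omega)).2).trans ((hL' (r + 1) (by omega)).2).symm

/-- The `h^*`-polynomial is unique. -/
theorem IsHStarPolynomial.unique {n : ℕ} {Λ : AddSubgroup (Fin n → ℝ)} {P : Set (Fin n → ℝ)}
    {h h' : Polynomial ℚ} (hh : IsHStarPolynomial Λ P h) (hh' : IsHStarPolynomial Λ P h') :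
    h = h' := by
  obtain ⟨L, hL, e⟩ := hh
  obtain ⟨L', hL', e'⟩ := hh'
  obtain rfl := hL.unique hL'
  exact Polynomial.coe_inj.mp (e.symm.trans e')

/-- The half-integer lattice `½ ℤⁿ` in `ℝⁿ`. -/
def halfIntegerLattice (n : ℕ) : AddSubgroup (Fin n → ℝ) where
  carrier := {x | ∀ i, ∃ m : ℤ, x i = (m : ℝ) / 2}
  zero_mem' := fun _ => ⟨0, by simp⟩
  add_mem' := fun {a b} ha hb i => by
    obtain ⟨p, hp⟩ := ha i
    obtain ⟨q, hq⟩ := hb i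
    exact ⟨p + q, by simp only [Pi.add_apply, hp, hq]; push_cast; ring⟩
  neg_mem' := fun {a} ha i => by
    obtain ⟨p, hp⟩ := ha i
    exact ⟨-p, by simp only [Pi.neg_apply, hp]; push_cast; ring⟩

/-! ### Type C hypersimplices

A point `(x_1, …, x_n)` of `ℝⁿ` is a function `x : Fin n → ℝ`, with `x_1 = x 0`. -/

/-- The fundamental parallelepiped `Π_{C_n}`: `0 ≤ 2 x_1 ≤ 1` and `0 ≤ x_{i+1} - x_i ≤ 1`
for `1 ≤ i < n`. -/
def parallelepipedC (n : ℕ) : Set (Fin n → ℝ) :=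
  {x | (∀ i : Fin n, (i : ℕ) = 0 → 0 ≤ 2 * x i ∧ 2 * x i ≤ 1) ∧
    ∀ i j : Fin n, (j : ℕ) = (i : ℕ) + 1 → 0 ≤ x j - x i ∧ x j - x i ≤ 1}

/-- The hypersimplex `Δ_{C_n,k}`: the points of `Π_{C_n}` with `k - 1 ≤ 2 x_n ≤ k`. -/
def hypersimplexC (n k : ℕ) : Set (Fin n → ℝ) :=
  {x | x ∈ parallelepipedC n ∧
    ∀ i : Fin n, (i : ℕ) + 1 = n → (k : ℝ) - 1 ≤ 2 * x i ∧ 2 * x i ≤ (k : ℝ)}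

/-- The half-open hypersimplex `Δ'_{C_n,k}`: it is `Δ_{C_n,1}` for `k = 1`, and otherwise the set
of points of `Π_{C_n}` with `k - 1 < 2 x_n ≤ k`. -/
def halfOpenHypersimplexC (n k : ℕ) : Set (Fin n → ℝ) :=
  if k = 1 then hypersimplexC n 1
  else {x | x ∈ parallelepipedC n ∧
    ∀ i : Fin n, (i : ℕ) + 1 = n → (k : ℝ) - 1 < 2 * x i ∧ 2 * x i ≤ (k : ℝ)}

/-! ### Signed permutations -/

/-- The set `{-n, …, -1, 1, …, n}`. -/
noncomputable def signedRange (n : ℕ) : Finset ℤ := (Finset.Icc (-(n : ℤ)) (n : ℤ)).erase 0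

noncomputable instance (n : ℕ) : Neg (signedRange n) where
  neg i := ⟨-(i : ℤ), by
    have h := i.2
    simp only [signedRange, Finset.mem_erase, Finset.mem_Icc] at h ⊢
    omega⟩

/-- The group `𝔅_n` of signed permutations: the permutations `w` of `{-n, …, -1, 1, …, n}`
with `w(-i) = -w(i)`. -/
noncomputable def signedPerms (n : ℕ) : Subgroup (Equiv.Perm (signedRange n)) where
  carrier := {w | ∀ i, w (-i) = -w i}
  one_mem' := fun _ => rfl
  mul_mem' := fun {a b} ha hb i => by
    rw [Equiv.Perm.mul_apply, Equiv.Perm.mul_apply, hb i, ha (b i)]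
  inv_mem' := fun {a} ha i => by
    rw [Equiv.Perm.inv_eq_iff_eq, ha]; simp

noncomputable instance (n : ℕ) : DecidablePred (· ∈ signedPerms n) :=
  fun w => inferInstanceAs (Decidable (∀ i, w (-i) = -w i))

/-- The entry `w_i = w(i)` for `i ∈ {-n, …, -1, 1, …, n}`, with the convention `w_0 = 0`
(and value `0` at the integers outside `[-n, n]`). -/
noncomputable def signedEntry {n : ℕ} (w : signedPerms n) (i : ℤ) : ℤ :=
  if h : i ∈ signedRange n then (w.1 ⟨i, h⟩ : ℤ) else 0

/-- `des_B(w)`: the number of `i ∈ {0, …, n - 1}` with `w_i > w_{i+1}`, where `w_0 = 0`. -/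
noncomputable def desB {n : ℕ} (w : signedPerms n) : ℕ :=
  ((Finset.Ico (0 : ℤ) n).filter fun i => signedEntry w i > signedEntry w (i + 1)).card

/-- `exc(w)`: the number of `i ∈ {1, …, n}` with `w_i > i`. -/
noncomputable def signedExc {n : ℕ} (w : signedPerms n) : ℕ :=
  ((Finset.Icc (1 : ℤ) n).filter fun i => signedEntry w i > i).card

/-- `neg(w)`: the number of `i ∈ {1, …, n}` with `w_i < 0`. -/
noncomputable def signedNeg {n : ℕ} (w : signedPerms n) : ℕ :=
  ((Finset.Icc (1 : ℤ) n).filter fun i => signedEntry w i < 0).card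

/-- The flag-excedance statistic `fexc(w) = 2 exc(w) + neg(w)`. -/
noncomputable def fexc {n : ℕ} (w : signedPerms n) : ℕ := 2 * signedExc w + signedNeg w

/-- The set `X_n` of the signed permutations `w` with `w⁻¹(1) > 0`. -/
noncomputable def setX (n : ℕ) : Finset (signedPerms n) :=
  Finset.univ.filter fun w => 0 < signedEntry w⁻¹ 1

/-! In doubled coordinates, a lattice point of the dilate `r P` is a sequence of `n` increments, the
first in `[0, r]` and the others in `[0, 2 r]`, whose sum lies in `((k - 1) r, k r]`, or in `[0, r]`
when `k = 1` (`smul_inter_halfIntegerLattice`). There are as many such sequences, before the sum is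
restricted, as words of length `n` on the alphabet `0 < -1 < 1 < ⋯ < -r < r` with nonnegative first
letter. The proof refines this equality by two statistics on words.

Standardization sends a word to the signed permutation that lists its positions in the order of
their letters, with the signs of the letters. The first letter is nonnegative exactly when the
result is in `X_n`. The fibre over `w` consists of the chains `0 ≤ b_1 ≤ ⋯ ≤ b_n ≤ r` that are
strict at the descents of `w`, so its generating function in `r` is `t ^ des_B(w) / (1 - t) ^ (n +
1)` (`mk_card_chainFinset`). Moreover `fexc w` is a weighted count of excedances of the word
(`excSum_eq_fexc`).

On the other side, mark a letter of a word if the last different letter before it is larger.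
Negative letters weigh 1 and marked nonnegative letters weigh 2. `wordIncrements` turns words
bijectively into increment sequences, in such a way that the sum is `r` times the total weight
`walkSum` plus a remainder in `[0, r]` that vanishes only for total weight 0. Hence weight `k - 1`
corresponds to the slice with index `k` (`ncard_signedWords_eq_ncard_incrementLists`).

It remains to see that excedances and marks are equidistributed on words (`exists_rearrangement`).
As in Foata's transformation, a word is read as a succession of closed walks on the letters, and the
letters visited right after `c` are collected in a block for `c`. The concatenated blocks form a
rearrangement whose block for `c` sits where the sorted word has the letter `c`, so a letter `t ≠ c`
there is an excedance exactly when `t < c`. Repetitions of `c` are placed so that those in runs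
entered from above become excedances and the others do not. The walk can be recovered from the
blocks, so the rearrangement is injective. -/

/-! ### A Foata-type rearrangement of words -/

/-- The events of the walk that visits the letters of a word. At `a` (the start letter of the current
closed walk) with current letter `c` and status `σ` (whether the current run of `c` was entered
from above), the walk either consumes the next letter `z`, or, when `c = a` has been used up,
stops and starts again at `a + 1`. -/
inductive IsWalk (N : ℕ) : ℕ → ℕ → Bool → List ℕ → List (ℕ × Bool × Option ℕ) → Prop
  | last (σ : Bool) : IsWalk N N N σ [] [(N, σ, none)]
  | next {a : ℕ} {σ : Bool} {Z : List ℕ} {E : List (ℕ × Bool × Option ℕ)} :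
      a < N → a ∉ Z → IsWalk N (a + 1) (a + 1) false Z E →
      IsWalk N a a σ Z ((a, σ, none) :: E)
  | step {a c : ℕ} {σ : Bool} {z : ℕ} {Z : List ℕ} {E : List (ℕ × Bool × Option ℕ)} :
      a ∈ z :: Z → a ≤ z → z ≤ N →
      IsWalk N a z (if z = c then σ else decide (z < c)) Z E →
      IsWalk N a c σ (z :: Z) ((c, σ, some z) :: E)

namespace IsWalk

/-- Every event consumes a letter or raises `a`, so `Z.length + (N - a)` drops. The hypothesis `c =
a ∨ a ∈ Z` ensures that the current walk is closed or can still be closed. -/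
theorem exists_of_bounds (N m : ℕ) : ∀ (a c : ℕ) (σ : Bool) (Z : List ℕ),
    Z.length + (N - a) = m → a ≤ N → (∀ z ∈ Z, a ≤ z ∧ z ≤ N) → (c = a ∨ a ∈ Z) →
    ∃ E, IsWalk N a c σ Z E := by
  induction m using Nat.strong_induction_on with
  | _ m ih =>
    intro a c σ Z hm ha hZ hc
    by_cases haZ : a ∈ Z
    · cases Z with
      | nil => simp at haZ
      | cons z Z =>
        have h1 := hZ z (by simp)
        obtain ⟨E, hE⟩ := ih (Z.length + (N - a)) (by simp at hm; omega) a z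
          (if z = c then σ else decide (z < c)) Z rfl ha
          (fun y hy => hZ y (by simp [hy])) (by
            rcases List.mem_cons.1 haZ with h | h
            · exact Or.inl h.symm
            · exact Or.inr h)
        exact ⟨_, .step haZ h1.1 h1.2 hE⟩
    · obtain rfl : c = a := by tauto
      rcases ha.lt_or_eq with h | rfl
      · obtain ⟨E, hE⟩ := ih (Z.length + (N - (c + 1))) (by omega) (c + 1) (c + 1) false Z rfl h
          (fun y hy => ⟨by
            have := (hZ y hy).1
            rcases this.lt_or_eq with h | rfl
            · exact h
            · exact absurd hy haZ, (hZ y hy).2⟩) (Or.inl rfl)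
        exact ⟨_, .next h haZ hE⟩
      · have : Z = [] := by
          apply List.eq_nil_iff_forall_not_mem.2
          intro z hz
          have := hZ z hz
          exact haZ (by rwa [show c = z by omega])
        subst this
        exact ⟨_, .last σ⟩

variable {N a c : ℕ} {σ : Bool} {Z : List ℕ} {E : List (ℕ × Bool × Option ℕ)}

theorem bounds (h : IsWalk N a c σ Z E) : ∀ z ∈ Z, a ≤ z ∧ z ≤ N := by
  induction h with
  | last σ => simp
  | next _ _ _ ih => intro z hz; have := ih z hz; omega
  | step _ h1 h2 _ ih => intro z hz; rcases List.mem_cons.1 hz with rfl | hz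
                         · exact ⟨h1, h2⟩
                         · exact ih z hz

theorem source_le (h : IsWalk N a c σ Z E) (hc : c ≤ N) : ∀ e ∈ E, e.1 ≤ N := by
  induction h with
  | last σ => simp
  | next h _ _ ih => intro e he; rcases List.mem_cons.1 he with rfl | he
                     · exact hc
                     · exact ih (by omega) e he
  | step _ _ h2 _ ih => intro e he; rcases List.mem_cons.1 he with rfl | he
                        · exact hc
                        · exact ih h2 e he

theorem filterMap_target (h : IsWalk N a c σ Z E) : E.filterMap (fun e => e.2.2) = Z := by
  induction h with
  | last σ => simp
  | next _ _ _ ih => simpa using ih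
  | step _ _ _ _ ih => simpa using ih

end IsWalk

/-! ### Events of a walk, sorted by letter and status -/

/-- For each event at the letter `c` with status `σ`, whether it repeats the letter `c`. -/
def walkRuns (E : List (ℕ × Bool × Option ℕ)) (c : ℕ) (σ : Bool) : List Bool :=
  (E.filter fun e => e.1 = c ∧ e.2.1 = σ).map fun e => decide (e.2.2 = some c)

/-- The letters other than `c` that the walk consumes when it is at `c`. -/
def walkExits (E : List (ℕ × Bool × Option ℕ)) (c : ℕ) : List ℕ :=
  E.filterMap fun e => if e.1 = c then e.2.2.filter (fun z => z ≠ c) else none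

theorem walkRuns_cons (e : ℕ × Bool × Option ℕ) (E : List (ℕ × Bool × Option ℕ)) (c : ℕ) (σ : Bool) :
    walkRuns (e :: E) c σ =
      if e.1 = c ∧ e.2.1 = σ then decide (e.2.2 = some c) :: walkRuns E c σ else walkRuns E c σ := by
  unfold walkRuns
  rw [List.filter_cons]
  by_cases h : e.1 = c ∧ e.2.1 = σ <;> simp [h]

theorem walkExits_cons_none (c : ℕ) (σ : Bool) (E : List (ℕ × Bool × Option ℕ)) (b : ℕ) :
    walkExits ((c, σ, none) :: E) b = walkExits E b := by
  unfold walkExits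
  by_cases h : c = b <;> simp [h]

theorem walkExits_cons_some (c : ℕ) (σ : Bool) (z : ℕ) (E : List (ℕ × Bool × Option ℕ)) (b : ℕ) :
    walkExits ((c, σ, some z) :: E) b =
      if c = b ∧ z ≠ b then z :: walkExits E b else walkExits E b := by
  unfold walkExits
  by_cases h : c = b <;> by_cases h' : z = b <;> simp [h, h', Option.filter]

theorem ne_of_mem_walkExits {E : List (ℕ × Bool × Option ℕ)} {c t : ℕ} (h : t ∈ walkExits E c) :
    t ≠ c := by
  unfold walkExits at h
  obtain ⟨e, -, he⟩ := List.mem_filterMap.1 h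
  split_ifs at he
  rw [Option.filter_eq_some_iff] at he
  simpa using he.2

namespace IsWalk

variable {N a c : ℕ} {σ : Bool} {Z : List ℕ} {E : List (ℕ × Bool × Option ℕ)}

/-- A walk is determined by its content and the events at each letter. -/
theorem eq_of_walkRuns_eq (h : IsWalk N a c σ Z E) : ∀ {Z' : List ℕ}
    {E' : List (ℕ × Bool × Option ℕ)}, IsWalk N a c σ Z' E' → Z.Perm Z' →
    (∀ b τ, walkRuns E b τ = walkRuns E' b τ) → (∀ b, walkExits E b = walkExits E' b) →
    Z = Z' := by
  induction h with
  | last σ =>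
    intro Z' E' h' hp _ _
    exact (List.nil_perm.1 hp).symm
  | @next a σ Z E h1 h2 _ ih =>
    intro Z' E' h' hp hr he
    cases h' with
    | last => omega
    | next h1' h2' h3' =>
      refine ih h3' hp (fun b τ => ?_) (fun b => ?_)
      · have := hr b τ
        rw [walkRuns_cons, walkRuns_cons] at this
        split_ifs at this
        · exact (List.cons.inj this).2
        · exact this
      · simpa only [walkExits_cons_none] using he b
    | step h1' => exact absurd (hp.mem_iff.2 h1') h2
  | @step a c σ z Z E h1 h2 h3 _ ih =>
    intro Z' E' h' hp hr he
    cases h' with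
    | last => simp at hp
    | next h1' h2' h3' => exact absurd (hp.mem_iff.1 h1) h2'
    | @step _ _ _ z' Z' E' h1' h2' h3' h4' =>
      -- The run list at `(c, σ)` tells whether the next letter repeats `c`; if it does not, the
      -- next letter heads the exit list at `c`.
      have hz : z = z' := by
        have hrc := hr c σ
        have hec := he c
        simp only [walkRuns_cons, and_self, if_true, List.cons.injEq, decide_eq_decide,
          Option.some.injEq] at hrc
        simp only [walkExits_cons_some, true_and] at hec
        by_cases hzc : z = c
        · rw [hzc, hrc.1.1 hzc]
        · have hzc' : z' ≠ c := fun h => hzc (hrc.1.2 h)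
          rw [if_pos hzc, if_pos hzc'] at hec
          exact (List.cons.inj hec).1
      subst hz
      congr 1
      refine ih h4' (List.perm_cons z |>.1 hp) (fun b τ => ?_) (fun b => ?_)
      · have := hr b τ
        rw [walkRuns_cons, walkRuns_cons] at this
        split_ifs at this
        · exact (List.cons.inj this).2
        · exact this
      · have := he b
        rw [walkExits_cons_some, walkExits_cons_some] at this
        split_ifs at this
        · exact (List.cons.inj this).2
        · exact this

/-- Each run ends once, so `false` entries count runs. A run of status `false` at `t` begins with an
arrival from below, is already open, or begins with the restart at `t`; these are the three terms.
-/
theorem count_false_walkRuns_false (h : IsWalk N a c σ Z E) (hac : a ≤ c) (t : ℕ) :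
    (walkRuns E t false).count false =
      E.countP (fun e => e.1 < t ∧ e.2.2 = some t) + (if c = t ∧ σ = false then 1 else 0)
        + (if a < t ∧ t ≤ N then 1 else 0) := by
  induction h with
  | last σ =>
    simp only [walkRuns_cons]
    by_cases h : N = t ∧ σ = false
    · simp [h, walkRuns]
    · rw [if_neg h, if_neg h]
      simp [walkRuns]
  | @next a σ Z E h1 h2 h3 ih =>
    rw [walkRuns_cons, List.countP_cons_of_neg (by simp)]
    have := ih le_rfl
    by_cases h : a = t ∧ σ = false
    · rw [if_pos h, if_pos h]
      simp only [reduceCtorEq, decide_false, List.count_cons_self]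
      rw [this]
      obtain ⟨rfl, -⟩ := h
      simp
    · rw [if_neg h, if_neg h, this]
      split_ifs <;> grind
  | @step a c σ z Z E h1 h2 h3 h4 ih =>
    rw [walkRuns_cons, List.countP_cons]
    have := ih h2
    by_cases h : c = t ∧ σ = false
    · rw [if_pos h, if_pos h, List.count_cons, this]
      obtain ⟨rfl, rfl⟩ := h
      by_cases hz : z = c
      · simp [hz]
      · simp [hz]
        omega
    · rw [if_neg h, if_neg h, this]
      by_cases hz : z = t
      · subst hz
        by_cases hzc : z = c
        · subst hzc
          simp
          grind
        · by_cases hlt : z < c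
          · simp [hzc, hlt, hlt.le]
          · have : c < z := by omega
            simp [hzc, this, this.le]
      · simp [hz]

theorem count_false_walkRuns_true (h : IsWalk N a c σ Z E) (t : ℕ) :
    (walkRuns E t true).count false =
      E.countP (fun e => t < e.1 ∧ e.2.2 = some t) + (if c = t ∧ σ = true then 1 else 0) := by
  induction h with
  | last σ =>
    simp only [walkRuns_cons]
    by_cases h : N = t ∧ σ = true
    · simp [h, walkRuns]
    · rw [if_neg h, if_neg h]
      simp [walkRuns]
  | @next a σ Z E h1 h2 h3 ih =>
    rw [walkRuns_cons, List.countP_cons_of_neg (by simp)]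
    by_cases h : a = t ∧ σ = true
    · rw [if_pos h, if_pos h]
      simp only [reduceCtorEq, decide_false, List.count_cons_self]
      rw [ih]
      simp
    · rw [if_neg h, if_neg h, ih]
      simp
  | @step a c σ z Z E h1 h2 h3 h4 ih =>
    rw [walkRuns_cons, List.countP_cons]
    by_cases h : c = t ∧ σ = true
    · rw [if_pos h, if_pos h, List.count_cons, ih]
      obtain ⟨rfl, rfl⟩ := h
      by_cases hz : z = c
      · simp [hz]
      · simp [hz]
    · rw [if_neg h, if_neg h, ih]
      by_cases hz : z = t
      · subst hz
        by_cases hzc : z = c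
        · subst hzc; simp; grind
        · by_cases hlt : z < c
          · simp [hzc, hlt]
          · simp [hzc, hlt]
      · simp [hz]

/-- A run at `t` ends by an exit to another letter or by the stop at `t`, which happens once for
each start letter still to be treated. -/
theorem count_false_walkRuns (h : IsWalk N a c σ Z E) (t : ℕ) :
    (walkRuns E t false).count false + (walkRuns E t true).count false =
      (walkExits E t).length + if a ≤ t ∧ t ≤ N then 1 else 0 := by
  induction h with
  | last σ =>
    cases σ <;> by_cases h : N = t <;> simp [walkRuns, walkExits, h] <;> grind
  | @next a σ Z E h1 h2 h3 ih =>
    rw [walkRuns_cons, walkRuns_cons, walkExits_cons_none]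
    by_cases h : a = t
    · subst h
      cases σ <;> simp at ih ⊢ <;> grind
    · simp only [h, false_and, if_false]
      rw [ih]
      split_ifs <;> grind
  | @step a c σ z Z E h1 h2 h3 h4 ih =>
    rw [walkRuns_cons, walkRuns_cons, walkExits_cons_some]
    by_cases h : c = t
    · subst h
      by_cases hz : z = c
      · cases σ <;> simp [hz] at ih ⊢ <;> omega
      · cases σ <;> simp [hz] at ih ⊢ <;> omega
    · simp only [h, false_and, if_false]
      exact ih

/-- An entered run must end, so no run list ends with a repetition. The first conjunct serves the
induction: a repetition leaves its run open, hence is never the last entry. -/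
theorem walkRuns_eq_nil_or (h : IsWalk N a c σ Z E) (t : ℕ) (τ : Bool) :
    (c = t ∧ σ = τ → walkRuns E t τ ≠ []) ∧
      (walkRuns E t τ = [] ∨ ∃ B, walkRuns E t τ = B ++ [false]) := by
  induction h with
  | last σ =>
    by_cases h : N = t ∧ σ = τ
    · simp [walkRuns, h]
    · simp [walkRuns, h]
  | @next a σ Z E h1 h2 h3 ih =>
    rw [walkRuns_cons]
    by_cases h : a = t ∧ σ = τ
    · rw [if_pos h]
      refine ⟨by simp, Or.inr ?_⟩
      rcases ih.2 with h | ⟨B, h⟩ <;> rw [h]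
      · exact ⟨[], rfl⟩
      · exact ⟨false :: B, rfl⟩
    · rw [if_neg h]
      exact ⟨fun h' => absurd h' h, ih.2⟩
  | @step a c σ z Z E h1 h2 h3 h4 ih =>
    rw [walkRuns_cons]
    by_cases h : c = t ∧ σ = τ
    · rw [if_pos h]
      refine ⟨by simp, Or.inr ?_⟩
      rcases ih.2 with h' | ⟨B, h'⟩
      · rw [h']
        by_cases hz : z = t
        · exact absurd h' (ih.1 ⟨hz, by rw [if_pos (hz.trans h.1.symm), h.2]⟩)
        · exact ⟨[], by simp [hz]⟩
      · rw [h']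
        exact ⟨_ :: B, rfl⟩
    · rw [if_neg h]
      exact ⟨fun h' => absurd h' h, ih.2⟩

end IsWalk

/-! ### Weaving repetitions and exits into blocks -/

/-- Insert copies of `c` into the list `F`: each `true` stands for a copy of `c`, and each `false`
for the next element of `F`. -/
def weave (c : ℕ) : List Bool → List ℕ → List ℕ
  | true :: B, F => c :: weave c B F
  | false :: B, t :: F => t :: weave c B F
  | _, _ => []

theorem weave_append_false (c : ℕ) (B : List Bool) : ∀ F : List ℕ, B.count false = F.length →
    weave c (B ++ [false]) F = weave c B F := by
  induction B with
  | nil => intro F h; cases F <;> simp_all [weave]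
  | cons b B ih =>
    intro F h
    cases b
    · cases F with
      | nil => simp at h
      | cons t F => simp [weave, ih F (by simpa using h)]
    · simp [weave, ih F (by simpa using h)]

theorem map_weave (c : ℕ) (B : List Bool) : ∀ F : List ℕ, B.count false = F.length →
    (∀ t ∈ F, t ≠ c) → (weave c B F).map (fun t => decide (t = c)) = B := by
  induction B with
  | nil => intro F h _; simp [weave]
  | cons b B ih =>
    intro F h hF
    cases b
    · cases F with
      | nil => simp at h
      | cons t F =>
        simp only [weave, List.map_cons]
        rw [ih F (by simpa using h) (fun s hs => hF s (by simp [hs]))]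
        simp [hF t (by simp)]
    · simp [weave, ih F (by simpa using h) hF]

theorem filter_weave (c : ℕ) (B : List Bool) : ∀ F : List ℕ, B.count false = F.length →
    (∀ t ∈ F, t ≠ c) → (weave c B F).filter (fun t => t ≠ c) = F := by
  induction B with
  | nil => intro F h _; cases F <;> simp_all [weave]
  | cons b B ih =>
    intro F h hF
    cases b
    · cases F with
      | nil => simp at h
      | cons t F =>
        rw [weave, List.filter_cons_of_pos (by simpa using hF t (by simp)),
          ih F (by simpa using h) (fun s hs => hF s (by simp [hs]))]
    · rw [weave, List.filter_cons_of_neg (by simp), ih F (by simpa using h) hF]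

theorem length_weave (c : ℕ) (B : List Bool) (F : List ℕ) (h : B.count false = F.length)
    (hF : ∀ t ∈ F, t ≠ c) : (weave c B F).length = B.length := by
  conv_rhs => rw [← map_weave c B F h hF]
  simp

theorem count_self_weave (c : ℕ) (B : List Bool) (F : List ℕ) (h : B.count false = F.length)
    (hF : ∀ t ∈ F, t ≠ c) : (weave c B F).count c = B.count true := by
  conv_rhs => rw [← map_weave c B F h hF]
  rw [List.count, List.count, List.countP_map]
  exact List.countP_congr (by simp)

theorem count_weave_of_ne {c t : ℕ} (htc : t ≠ c) (B : List Bool) (F : List ℕ)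
    (h : B.count false = F.length) (hF : ∀ t ∈ F, t ≠ c) : (weave c B F).count t = F.count t := by
  conv_rhs => rw [← filter_weave c B F h hF]
  rw [List.count_filter (by simpa using htc)]

/-- The block of successors of the letter `c` in a walk. -/
def walkBlock (E : List (ℕ × Bool × Option ℕ)) (c : ℕ) : List ℕ :=
  weave c (walkRuns E c false ++ walkRuns E c true) (walkExits E c)

theorem count_true_walkRuns (E : List (ℕ × Bool × Option ℕ)) (c : ℕ) :
    (walkRuns E c false).count true + (walkRuns E c true).count true =
      E.countP (fun e => e.1 = c ∧ e.2.2 = some c) := by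
  induction E with
  | nil => simp [walkRuns]
  | cons e E ih =>
    obtain ⟨b, τ, o⟩ := e
    rw [walkRuns_cons, walkRuns_cons, List.countP_cons, ← ih]
    by_cases hb : b = c
    · by_cases ho : o = some c <;> cases τ <;> simp [hb, ho] <;> omega
    · simp [hb]

theorem count_walkExits (E : List (ℕ × Bool × Option ℕ)) {c t : ℕ} (h : t ≠ c) :
    (walkExits E c).count t = E.countP (fun e => e.1 = c ∧ e.2.2 = some t) := by
  induction E with
  | nil => simp [walkExits]
  | cons e E ih =>
    obtain ⟨b, τ, o⟩ := e
    cases o with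
    | none => rw [walkExits_cons_none, List.countP_cons, ih]; simp
    | some z =>
      rw [walkExits_cons_some, List.countP_cons, ← ih]
      by_cases hb : b = c
      · by_cases hz : z = c
        · subst hz
          simp [hb, h.symm]
        · simp [hb, hz, List.count_cons]
      · simp [hb]

theorem sum_countP_eq {α : Type*} (E : List (ℕ × α)) (p : α → Bool) (m : ℕ) :
    ∑ b ∈ Finset.range m, E.countP (fun e => e.1 = b ∧ p e.2) =
      E.countP (fun e => e.1 < m ∧ p e.2) := by
  induction E with
  | nil => simp
  | cons e E ih =>
    simp only [List.countP_cons, Finset.sum_add_distrib, ih]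
    congr 1
    by_cases hp : p e.2 <;> simp [hp]

namespace IsWalk

variable {N a c : ℕ} {σ : Bool} {Z : List ℕ} {E : List (ℕ × Bool × Option ℕ)}

theorem countP_target (h : IsWalk N a c σ Z E) (t : ℕ) :
    E.countP (fun e => e.2.2 = some t) = Z.count t := by
  rw [← h.filterMap_target, List.count, List.countP_filterMap]
  refine List.countP_congr fun e _ => ?_
  cases e.2.2 <;> simp

/-- There is one run more than there are exits, because of the stop at `t`. The surplus `false` can
be taken to be the last one, where `weave` ignores it. -/
theorem exists_walkRuns_append_eq (h : IsWalk N 0 0 false Z E) {t : ℕ} (ht : t ≤ N) :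
    ∃ B, walkRuns E t false ++ walkRuns E t true = B ++ [false] ∧
      B.count false = (walkExits E t).length := by
  have h0 := h.count_false_walkRuns t
  simp only [zero_le, ht, and_self, if_true] at h0
  have key : ∃ B, walkRuns E t false ++ walkRuns E t true = B ++ [false] := by
    rcases (h.walkRuns_eq_nil_or t true).2 with h1 | ⟨B, h1⟩
    · rcases (h.walkRuns_eq_nil_or t false).2 with h2 | ⟨B, h2⟩
      · simp [h1, h2] at h0
      · exact ⟨B, by simp [h1, h2]⟩
    · exact ⟨walkRuns E t false ++ B, by simp [h1]⟩
  obtain ⟨B, hB⟩ := key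
  refine ⟨B, hB, ?_⟩
  rw [← List.count_append, hB, List.count_append] at h0
  simpa using h0

theorem count_walkBlock (h : IsWalk N 0 0 false Z E) {c : ℕ} (hc : c ≤ N) (t : ℕ) :
    (walkBlock E c).count t = E.countP (fun e => e.1 = c ∧ e.2.2 = some t) := by
  obtain ⟨B, hB, hF⟩ := h.exists_walkRuns_append_eq hc
  rw [walkBlock, hB, weave_append_false _ _ _ hF]
  by_cases htc : t = c
  · subst htc
    rw [count_self_weave _ _ _ hF fun s => ne_of_mem_walkExits, ← count_true_walkRuns,
      ← List.count_append, hB]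
    simp
  · rw [count_weave_of_ne htc _ _ hF fun s => ne_of_mem_walkExits, count_walkExits _ htc]

theorem countP_lt_target (h : IsWalk N 0 0 false Z E) {t : ℕ} (ht : t ≤ N) :
    E.countP (fun e => e.1 < t ∧ e.2.2 = some t) + 1 = (walkRuns E t false).count false := by
  rw [h.count_false_walkRuns_false le_rfl t]
  by_cases h0 : t = 0
  · simp [h0]
  · simp [ht, Nat.pos_of_ne_zero h0, Ne.symm h0]

/-- All walks are closed, so `t` is left as often as it is reached: the runs at `t` are the arrivals
from below, those from above and one start, while all but one of the runs end with an exit. -/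
theorem length_walkBlock (h : IsWalk N 0 0 false Z E) {t : ℕ} (ht : t ≤ N) :
    (walkBlock E t).length = Z.count t := by
  obtain ⟨B, hB, hF⟩ := h.exists_walkRuns_append_eq ht
  rw [walkBlock, hB, weave_append_false _ _ _ hF,
    length_weave _ _ _ hF fun s => ne_of_mem_walkExits, ← h.countP_target t]
  have h1 : (walkRuns E t false ++ walkRuns E t true).length = B.length + 1 := by rw [hB]; simp
  have h2 : ∀ l : List Bool, l.length = l.count true + l.count false := fun l => (List.count_true_add_count_false l).symm
  have h3 := h.countP_lt_target ht
  have h4 := h.count_false_walkRuns_true t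
  have h5 := count_true_walkRuns E t
  rw [List.length_append, h2 (walkRuns E t false), h2 (walkRuns E t true)] at h1
  have h6 : E.countP (fun e => e.2.2 = some t) = E.countP (fun e => e.1 = t ∧ e.2.2 = some t)
      + E.countP (fun e => e.1 < t ∧ e.2.2 = some t)
      + E.countP (fun e => t < e.1 ∧ e.2.2 = some t) := by
    clear h1 h2 h3 h4 h5 hB hF h
    induction E with
    | nil => simp
    | cons e E ih =>
      simp only [List.countP_cons, ih]
      by_cases he : e.2.2 = some t
      · rcases lt_trichotomy e.1 t with hlt | heq | hgt
        · simp [he, hlt, hlt.ne, hlt.not_gt]; omega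
        · simp [he, heq]; omega
        · simp [he, hgt, hgt.ne', hgt.not_gt]; omega
      · simp [he]
  simp only [Bool.false_eq_true, and_false, if_false, add_zero] at h4
  have h7 := h.count_false_walkRuns t
  simp only [zero_le, ht, and_self, if_true] at h7
  omega

end IsWalk

/-! ### Recovering a walk from its blocks -/

/-- The concatenation of the first `m` blocks of a walk. -/
def walkBlocks (E : List (ℕ × Bool × Option ℕ)) : ℕ → List ℕ
  | 0 => []
  | m + 1 => walkBlocks E m ++ walkBlock E m

theorem exists_walkBlocks_append (E : List (ℕ × Bool × Option ℕ)) {m k : ℕ} (h : m ≤ k) :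
    ∃ l, walkBlocks E k = walkBlocks E m ++ l := by
  induction k, h using Nat.le_induction with
  | base => exact ⟨[], by simp⟩
  | succ k _ ih =>
    obtain ⟨l, hl⟩ := ih
    exact ⟨l ++ walkBlock E k, by rw [walkBlocks, hl, List.append_assoc]⟩

namespace IsWalk

variable {N a c : ℕ} {σ : Bool} {Z : List ℕ} {E : List (ℕ × Bool × Option ℕ)}

theorem count_walkBlocks (h : IsWalk N 0 0 false Z E) {m : ℕ} (hm : m ≤ N + 1) (t : ℕ) :
    (walkBlocks E m).count t = E.countP (fun e => e.1 < m ∧ e.2.2 = some t) := by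
  have h1 := sum_countP_eq E (fun x => decide (x.2 = some t)) m
  simp only [decide_eq_true_eq] at h1
  rw [← h1]
  clear h1
  induction m with
  | zero => simp [walkBlocks]
  | succ m ih =>
    rw [walkBlocks, List.count_append, ih (by omega), Finset.sum_range_succ,
      h.count_walkBlock (by omega)]

theorem perm_walkBlocks (h : IsWalk N 0 0 false Z E) : (walkBlocks E (N + 1)).Perm Z := by
  rw [List.perm_iff_count]
  intro t
  rw [h.count_walkBlocks le_rfl, ← h.countP_target]
  refine List.countP_congr fun e he => ?_
  have := h.source_le (Nat.zero_le _) e he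
  simp; omega

theorem walkBlock_eq_of_walkBlocks_eq {Z' : List ℕ} {E' : List (ℕ × Bool × Option ℕ)}
    (h : IsWalk N 0 0 false Z E) (h' : IsWalk N 0 0 false Z' E') (hp : Z.Perm Z') {m : ℕ}
    (hm : m ≤ N + 1) (he : walkBlocks E m = walkBlocks E' m) :
    ∀ t < m, walkBlock E t = walkBlock E' t := by
  induction m with
  | zero => simp
  | succ m ih =>
    have hl : (walkBlock E m).length = (walkBlock E' m).length := by
      rw [h.length_walkBlock (by omega), h'.length_walkBlock (by omega), hp.count_eq]
    obtain ⟨h1, h2⟩ := List.append_inj' he hl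
    intro t ht
    rcases Nat.lt_succ_iff_lt_or_eq.1 ht with ht | rfl
    · exact ih (by omega) h1 t ht
    · exact h2

theorem walkRuns_of_lt {t : ℕ} (h : IsWalk N a c σ Z E) (ht : N < t) (hc : c ≤ N) (τ : Bool) :
    walkRuns E t τ = [] := by
  unfold walkRuns
  rw [List.map_eq_nil_iff, List.filter_eq_nil_iff]
  intro e he
  have := h.source_le hc e he
  simp; omega

theorem walkExits_of_lt {t : ℕ} (h : IsWalk N a c σ Z E) (ht : N < t) (hc : c ≤ N) :
    walkExits E t = [] := by
  unfold walkExits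
  rw [List.filterMap_eq_nil_iff]
  intro e he
  have := h.source_le hc e he
  rw [if_neg (by omega)]

/-- The content fixes the block lengths, so the concatenation can be cut into blocks. A block for
`t` yields its exits and the joined run lists. These are cut after as many `false` entries as there
are copies of `t` in earlier blocks, plus one. -/
theorem eq_of_walkBlocks_eq {Z' : List ℕ} {E' : List (ℕ × Bool × Option ℕ)}
    (h : IsWalk N 0 0 false Z E) (h' : IsWalk N 0 0 false Z' E')
    (he : walkBlocks E (N + 1) = walkBlocks E' (N + 1)) : Z = Z' := by
  have hp : Z.Perm Z' := h.perm_walkBlocks.symm.trans (he ▸ h'.perm_walkBlocks)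
  have hb := h.walkBlock_eq_of_walkBlocks_eq h' hp le_rfl he
  have key : ∀ t ≤ N, walkExits E t = walkExits E' t ∧
      walkRuns E t false = walkRuns E' t false ∧ walkRuns E t true = walkRuns E' t true := by
    intro t ht
    obtain ⟨B, hB, hF⟩ := h.exists_walkRuns_append_eq ht
    obtain ⟨B', hB', hF'⟩ := h'.exists_walkRuns_append_eq ht
    have h1 := hb t (by omega)
    rw [walkBlock, walkBlock, hB, hB', weave_append_false _ _ _ hF,
      weave_append_false _ _ _ hF'] at h1
    have h2 : walkExits E t = walkExits E' t := by
      rw [← filter_weave t B _ hF fun s => ne_of_mem_walkExits, h1,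
        filter_weave t B' _ hF' fun s => ne_of_mem_walkExits]
    have h3 : B = B' := by
      rw [← map_weave t B _ hF fun s => ne_of_mem_walkExits, h1,
        map_weave t B' _ hF' fun s => ne_of_mem_walkExits]
    have h4 : (walkRuns E t false).count false = (walkRuns E' t false).count false := by
      rw [← h.countP_lt_target ht, ← h'.countP_lt_target ht]
      have e1 := h.count_walkBlocks (m := t) (by omega) t
      have e2 := h'.count_walkBlocks (m := t) (by omega) t
      rw [← e1, ← e2]
      have : ∀ m ≤ t, walkBlocks E m = walkBlocks E' m := by
        intro m
        induction m with
        | zero => intro _; rfl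
        | succ m ih => intro hm; rw [walkBlocks, walkBlocks, ih (by omega), hb m (by omega)]
      rw [this t le_rfl]
    refine ⟨h2, ?_⟩
    have h5 : walkRuns E t false ++ walkRuns E t true =
        walkRuns E' t false ++ walkRuns E' t true := by rw [hB, hB', h3]
    -- A prefix that ends in `false` is determined by its number of `false` entries.
    have h6 : ∀ l₁ l₂ l₁' l₂' : List Bool, l₁ ++ l₂ = l₁' ++ l₂' →
        l₁.count false = l₁'.count false → (∃ l, l₁ = l ++ [false]) → (∃ l, l₁' = l ++ [false]) →
        l₁ = l₁' := by
      rintro l₁ l₂ l₁' l₂' e hc ⟨m, rfl⟩ ⟨m', rfl⟩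
      rcases List.append_eq_append_iff.1 e with ⟨x, hx, -⟩ | ⟨x, hx, -⟩
      · rcases List.eq_nil_or_concat x with rfl | ⟨y, b, rfl⟩
        · simpa using hx.symm
        · exfalso
          have hx' : m' ++ [false] = (m ++ [false] ++ y) ++ [b] := by simpa using hx
          obtain ⟨hx1, hx2⟩ := List.append_inj' hx' rfl
          rw [hx] at hc
          obtain rfl : false = b := by simpa using hx2
          simp at hc
      · rcases List.eq_nil_or_concat x with rfl | ⟨y, b, rfl⟩
        · simpa using hx
        · exfalso
          have hx' : m ++ [false] = (m' ++ [false] ++ y) ++ [b] := by simpa using hx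
          obtain ⟨hx1, hx2⟩ := List.append_inj' hx' rfl
          rw [hx] at hc
          obtain rfl : false = b := by simpa using hx2
          simp at hc
    have h7 : ∀ {Z : List ℕ} {E : List (ℕ × Bool × Option ℕ)}, IsWalk N 0 0 false Z E →
        ∃ l, walkRuns E t false = l ++ [false] := by
      intro Z E h
      rcases (h.walkRuns_eq_nil_or t false).2 with h8 | h8
      · have := h.countP_lt_target ht
        rw [h8] at this
        simp at this
      · exact h8
    have h8 := h6 _ _ _ _ h5 h4 (h7 h) (h7 h')
    rw [h8] at h5
    exact ⟨h8, List.append_cancel_left h5⟩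
  refine h.eq_of_walkRuns_eq h' hp (fun t τ => ?_) (fun t => ?_)
  · rcases le_or_gt t N with ht | ht
    · cases τ
      · exact (key t ht).2.1
      · exact (key t ht).2.2
    · rw [h.walkRuns_of_lt ht (Nat.zero_le _), h'.walkRuns_of_lt ht (Nat.zero_le _)]
  · rcases le_or_gt t N with ht | ht
    · exact (key t ht).1
    · rw [h.walkExits_of_lt ht (Nat.zero_le _), h'.walkExits_of_lt ht (Nat.zero_le _)]

end IsWalk

theorem walkRuns_eq_nil {E : List (ℕ × Bool × Option ℕ)} {t : ℕ} (h : ∀ e ∈ E, e.1 ≠ t) (τ : Bool) :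
    walkRuns E t τ = [] := by
  unfold walkRuns
  rw [List.map_eq_nil_iff, List.filter_eq_nil_iff]
  intro e he
  simp [h e he]

theorem walkExits_eq_nil {E : List (ℕ × Bool × Option ℕ)} {t : ℕ} (h : ∀ e ∈ E, e.1 ≠ t) :
    walkExits E t = [] := by
  unfold walkExits
  rw [List.filterMap_eq_nil_iff]
  intro e he
  rw [if_neg (h e he)]

namespace IsWalk

variable {N a c : ℕ} {σ : Bool} {Z : List ℕ} {E : List (ℕ × Bool × Option ℕ)}

theorem le_source (h : IsWalk N a c σ Z E) (hac : a ≤ c) : ∀ e ∈ E, a ≤ e.1 := by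
  induction h with
  | last σ => simp
  | next h _ _ ih =>
    intro e he
    rcases List.mem_cons.1 he with rfl | he
    · exact hac
    · exact (Nat.le_succ _).trans (ih le_rfl e he)
  | step _ h1 _ _ ih =>
    intro e he
    rcases List.mem_cons.1 he with rfl | he
    · exact hac
    · exact ih h1 e he

/-- The first event has status `false`, and runs of that status come first in a block, so the first
letter consumed heads the block of the start letter. If the start letter does not occur, its block
is empty. -/
theorem head?_walkBlocks (h : IsWalk N a c σ Z E) (hc : c = a) (hσ : σ = false) :
    (walkBlocks E (N + 1)).head? = Z.head? := by
  induction h with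
  | last σ =>
    have : ∀ m, walkBlocks [(N, σ, none)] m = [] := by
      intro m
      induction m with
      | zero => rfl
      | succ m ih =>
        rw [walkBlocks, ih, walkBlock, walkExits_cons_none, walkRuns_cons, walkRuns_cons]
        cases σ <;> by_cases h : N = m <;> simp [h, walkRuns, walkExits, weave]
    rw [this]
  | @next a σ Z E h1 h2 h3 ih =>
    rw [← ih rfl rfl]
    subst hσ
    have hE : ∀ e ∈ E, e.1 ≠ a := fun e he => by have := h3.le_source le_rfl e he; omega
    have : ∀ m, walkBlocks ((a, false, none) :: E) m = walkBlocks E m := by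
      intro m
      induction m with
      | zero => rfl
      | succ m ih =>
        rw [walkBlocks, ih, walkBlocks]
        congr 1
        rw [walkBlock, walkExits_cons_none, walkRuns_cons, walkRuns_cons, walkBlock]
        by_cases h : a = m
        · subst h
          simp [walkRuns_eq_nil hE, walkExits_eq_nil hE, weave]
        · simp [h]
    rw [this]
  | @step a c σ z Z E h1 h2 h3 h4 ih =>
    subst hσ hc
    have hE : ∀ e ∈ (c, false, some z) :: E, c ≤ e.1 :=
      (IsWalk.step (c := c) (σ := false) h1 h2 h3 h4).le_source le_rfl
    have h0 : ∀ m ≤ c, walkBlocks ((c, false, some z) :: E) m = [] := by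
      intro m
      induction m with
      | zero => intro _; rfl
      | succ m ih =>
        intro hm
        have hE' : ∀ e ∈ (c, false, some z) :: E, e.1 ≠ m := fun e he => by
          have := hE e he; omega
        rw [walkBlocks, ih (by omega), walkBlock, walkRuns_eq_nil hE', walkRuns_eq_nil hE',
          walkExits_eq_nil hE']
        rfl
    obtain ⟨l, hl⟩ := exists_walkBlocks_append ((c, false, some z) :: E)
      (show c + 1 ≤ N + 1 by omega)
    rw [hl, walkBlocks, h0 c le_rfl, walkBlock, walkRuns_cons, walkExits_cons_some]
    by_cases hz : z = c <;> simp [hz, weave]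

end IsWalk

/-! ### Excedances of the rearranged word -/

/-- The sum over the entries `t` of the second list of `g t e`, where `e` says whether the entry is an
excedance, that is, whether its rank in the standardization of `f` is less than its position. -/
def excSumAux (g : ℕ → Bool → ℕ) (f : List ℕ) : List ℕ → List ℕ → ℕ
  | _, [] => 0
  | pre, t :: l => g t (decide (f.countP (fun x => x < t) + pre.count t < pre.length)) +
      excSumAux g f (pre ++ [t]) l

theorem excSumAux_append (g : ℕ → Bool → ℕ) (f l₁ l₂ : List ℕ) : ∀ pre,
    excSumAux g f pre (l₁ ++ l₂) = excSumAux g f pre l₁ + excSumAux g f (pre ++ l₁) l₂ := by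
  induction l₁ with
  | nil => simp [excSumAux]
  | cons t l ih => intro pre; simp [excSumAux, ih, add_assoc]

/-- The sum over the entries `z` of a word of `g z σ`, where `σ` says whether the last
entry different from `z` that precedes it is larger. -/
def walkSum (g : ℕ → Bool → ℕ) : ℕ → Bool → List ℕ → ℕ
  | _, _, [] => 0
  | p, σ, z :: Z => g z (if z = p then σ else decide (z < p)) +
      walkSum g z (if z = p then σ else decide (z < p)) Z

/-- The contribution to `excSumAux` of a block of the letter `c`, with `s` copies of `c` before the
block, and `k` other letters before in the block. -/
def blockSum (g : ℕ → Bool → ℕ) (c s : ℕ) : ℕ → List ℕ → ℕ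
  | _, [] => 0
  | k, t :: l => if t = c then g c (decide (s < k)) + blockSum g c s k l
      else g t (decide (t < c)) + blockSum g c s (k + 1) l

/-- The contribution of the copies of `c` in a block. -/
def gapSum (g : ℕ → Bool → ℕ) (c s : ℕ) : ℕ → List Bool → ℕ
  | _, [] => 0
  | k, true :: B => g c (decide (s < k)) + gapSum g c s k B
  | k, false :: B => gapSum g c s (k + 1) B

theorem gapSum_append (g : ℕ → Bool → ℕ) (c s : ℕ) (B₁ B₂ : List Bool) : ∀ k,
    gapSum g c s k (B₁ ++ B₂) = gapSum g c s k B₁ + gapSum g c s (k + B₁.count false) B₂ := by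
  induction B₁ with
  | nil => simp [gapSum]
  | cons b B ih =>
    intro k
    cases b
    · simp only [List.cons_append, gapSum, ih, List.count_cons_self]
      rw [show k + 1 + B.count false = k + (B.count false + 1) by omega]
    · simp [gapSum, ih, add_assoc]

theorem gapSum_of_lt (g : ℕ → Bool → ℕ) (c s : ℕ) (B : List Bool) : ∀ k, s < k →
    gapSum g c s k B = B.count true * g c true := by
  induction B with
  | nil => simp [gapSum]
  | cons b B ih =>
    intro k hk
    cases b
    · simp [gapSum, ih (k + 1) (by omega)]
    · simp [gapSum, ih k hk, hk]; ring

theorem gapSum_of_le (g : ℕ → Bool → ℕ) (c s : ℕ) (B : List Bool) : ∀ k, k + B.count false ≤ s →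
    gapSum g c s k B = B.count true * g c false := by
  induction B with
  | nil => simp [gapSum]
  | cons b B ih =>
    intro k hk
    cases b
    · simp only [List.count_cons_self] at hk
      simp [gapSum, ih (k + 1) (by omega)]
    · have hk' : k + B.count false ≤ s := by simpa using hk
      have : ¬ s < k := by omega
      simp [gapSum, ih k hk', this]; ring

theorem blockSum_weave (g : ℕ → Bool → ℕ) (c s : ℕ) (B : List Bool) : ∀ (k : ℕ) (F : List ℕ),
    B.count false = F.length → (∀ t ∈ F, t ≠ c) →
    blockSum g c s k (weave c B F) =
      (F.map fun t => g t (decide (t < c))).sum + gapSum g c s k B := by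
  induction B with
  | nil => intro k F h _; cases F <;> simp_all [weave, blockSum, gapSum]
  | cons b B ih =>
    intro k F h hF
    cases b
    · cases F with
      | nil => simp at h
      | cons t F =>
        rw [weave, blockSum, if_neg (hF t (by simp)),
          ih _ _ (by simpa using h) fun s hs => hF s (by simp [hs])]
        simp [gapSum, add_assoc]
    · rw [weave, blockSum, if_pos rfl, ih _ _ (by simpa using h) hF]
      simp only [gapSum]; ring

/-- The block occupies the positions that the letters `c` take in the sorted word, so any smaller
letter in it has rank before the block and any larger one has rank after it. For a copy of `c`, both
rank and position are counted from the start of the block: the rank exceeds the number of copies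
already in the block by the copies in `pre`, the position by the other letters. -/
theorem excSumAux_block (g : ℕ → Bool → ℕ) {f pre L suf : List ℕ} {c : ℕ}
    (hf : f = pre ++ L ++ suf) (hpre : pre.length = f.countP (fun x => x < c))
    (hL : L.length = f.count c) : ∀ (l M : List ℕ), L = M ++ l →
    excSumAux g f (pre ++ M) l = blockSum g c (pre.count c) (M.countP (fun x => x ≠ c)) l := by
  intro l
  induction l with
  | nil => intro M _; rfl
  | cons t l ih =>
    intro M hM
    have hlen : L.length = M.length + l.length + 1 := by rw [hM]; simp; omega
    have hM' : M.length = M.count c + M.countP (fun x => x ≠ c) := by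
      rw [List.length_eq_countP_add_countP (fun x => x = c)]
      congr 1
      exact List.countP_congr (by simp)
    have hsplit : ∀ u, f.countP (fun x => x < u) + f.count u = f.countP (fun x => x ≤ u) := by
      intro u
      clear ih hL hpre hf
      induction f with
      | nil => rfl
      | cons x f ih =>
        rw [List.countP_cons, List.countP_cons, List.count_cons, ← ih]
        rcases lt_trichotomy x u with h | h | h
        · simp [h, h.le, h.ne]; omega
        · simp [h]; omega
        · simp [h.ne', h.not_ge, h.not_gt]
    have hmono : ∀ {p q : ℕ → Prop} [DecidablePred p] [DecidablePred q], (∀ x, p x → q x) →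
        f.countP (fun x => p x) ≤ f.countP (fun x => q x) := by
      intro p q _ _ hpq
      exact List.countP_mono_left fun x _ hx => by simpa using hpq x (by simpa using hx)
    rw [excSumAux, blockSum, List.append_assoc, ih (M ++ [t]) (by simp [hM])]
    rcases lt_trichotomy t c with h | h | h
    · rw [if_neg h.ne]
      have h1 : (pre ++ M).count t + 1 ≤ f.count t := by
        rw [hf, hM]; simp
      have h2 := hsplit t
      have h3 : f.countP (fun x => x ≤ t) ≤ f.countP (fun x => x < c) :=
        hmono fun x hx => lt_of_le_of_lt hx h
      have h4 : f.countP (fun x => x < t) + (pre ++ M).count t < (pre ++ M).length := by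
        rw [List.length_append]; omega
      simp only [h4, h]
      simp [h.ne, List.countP_append]
    · subst h
      rw [if_pos rfl]
      have : f.countP (fun x => x < t) + (pre ++ M).count t < (pre ++ M).length ↔
          pre.count t < M.countP (fun x => x ≠ t) := by
        rw [← hpre, List.length_append, List.count_append]; omega
      simp only [this]
      simp [List.countP_append]
    · rw [if_neg h.ne']
      have h2 := hsplit c
      have h3 : f.countP (fun x => x ≤ c) ≤ f.countP (fun x => x < t) :=
        hmono fun x hx => lt_of_le_of_lt hx h
      have h4 : ¬ f.countP (fun x => x < t) + (pre ++ M).count t < (pre ++ M).length := by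
        rw [List.length_append]; omega
      simp only [h4, h.not_gt]
      simp [h.ne', List.countP_append]

/-- The weight of an event of a walk. -/
def eventWeight (g : ℕ → Bool → ℕ) : ℕ × Bool × Option ℕ → ℕ
  | (_, _, none) => 0
  | (c, σ, some z) => g z (if z = c then σ else decide (z < c))

theorem sum_eventWeight_filter (g : ℕ → Bool → ℕ) (E : List (ℕ × Bool × Option ℕ)) (c : ℕ) :
    ((E.filter fun e => e.1 = c).map (eventWeight g)).sum =
      ((walkExits E c).map fun t => g t (decide (t < c))).sum +
        ((walkRuns E c false).count true * g c false +
          (walkRuns E c true).count true * g c true) := by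
  induction E with
  | nil => simp [walkRuns, walkExits]
  | cons e E ih =>
    obtain ⟨b, τ, o⟩ := e
    rw [walkRuns_cons, walkRuns_cons, List.filter_cons]
    by_cases hb : b = c
    · subst hb
      cases o with
      | none =>
        rw [walkExits_cons_none]
        cases τ <;> simp [eventWeight, ih]
      | some z =>
        rw [walkExits_cons_some]
        by_cases hz : z = b
        · cases τ <;> simp [eventWeight, hz, ih] <;> ring
        · cases τ <;> simp [eventWeight, hz, ih] <;> ring
    · cases o with
      | none => simpa [walkExits_cons_none, hb] using ih
      | some z => simpa [walkExits_cons_some, hb] using ih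

theorem sum_filter_source {α : Type*} (w : ℕ × α → ℕ) (E : List (ℕ × α)) (m : ℕ)
    (h : ∀ e ∈ E, e.1 < m) :
    ∑ c ∈ Finset.range m, ((E.filter fun e => e.1 = c).map w).sum = (E.map w).sum := by
  induction E with
  | nil => simp
  | cons e E ih =>
    rw [List.map_cons, List.sum_cons, ← ih fun x hx => h x (by simp [hx])]
    have : ∀ c, (((e :: E).filter fun e => e.1 = c).map w).sum =
        (if e.1 = c then w e else 0) + ((E.filter fun e => e.1 = c).map w).sum := by
      intro c
      by_cases hc : e.1 = c <;> simp [hc]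
    simp only [this, Finset.sum_add_distrib]
    simp [h e (by simp)]

namespace IsWalk

variable {N a c : ℕ} {σ : Bool} {Z : List ℕ} {E : List (ℕ × Bool × Option ℕ)}

/-- A restart at `a + 1` with status `false` does not alter any mark: only letters above `a` remain,
so the next letter is unmarked whether it is compared with `a` or with `a + 1`. -/
theorem sum_eventWeight (g : ℕ → Bool → ℕ) (h : IsWalk N a c σ Z E) :
    (E.map (eventWeight g)).sum = walkSum g c σ Z := by
  induction h with
  | last σ => simp [eventWeight, walkSum]
  | @next a σ Z E h1 h2 h3 ih =>
    simp only [List.map_cons, List.sum_cons, eventWeight, ih, zero_add]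
    cases Z with
    | nil => rfl
    | cons z Z =>
      have hz := (h3.bounds z (by simp)).1
      have h4 : (if z = a + 1 then false else decide (z < a + 1)) = false := by
        split_ifs <;> simp; omega
      have h5 : (if z = a then σ else decide (z < a)) = false := by
        rw [if_neg (by omega)]; simp; omega
      rw [walkSum, walkSum, h4, h5]
  | @step a c σ z Z E h1 h2 h3 h4 ih =>
    simp [eventWeight, walkSum, ih]

theorem excSumAux_walkBlocks (g : ℕ → Bool → ℕ) (h : IsWalk N 0 0 false Z E) :
    excSumAux g (walkBlocks E (N + 1)) [] (walkBlocks E (N + 1)) = walkSum g 0 false Z := by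
  rw [← h.sum_eventWeight g, ← sum_filter_source (eventWeight g) E (N + 1)
    fun e he => Nat.lt_succ_of_le (h.source_le (Nat.zero_le _) e he)]
  have hlen : ∀ m ≤ N + 1, (walkBlocks E m).length =
      (walkBlocks E (N + 1)).countP (fun x => x < m) := by
    intro m
    induction m with
    | zero => simp [walkBlocks]
    | succ m ih =>
      intro hm
      rw [walkBlocks, List.length_append, ih (by omega), h.length_walkBlock (by omega),
        ← h.perm_walkBlocks.count_eq]
      generalize walkBlocks E (N + 1) = f
      clear ih
      induction f with
      | nil => rfl
      | cons x f ih =>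
        rw [List.countP_cons, List.countP_cons, List.count_cons, ← ih]
        rcases lt_trichotomy x m with h | h | h
        · simp [h, h.ne, h.trans (Nat.lt_succ_self m)]; omega
        · simp [h]; omega
        · have : ¬ x < m + 1 := by omega
          simp [h.ne', h.not_gt, this]
  have key : ∀ m ≤ N + 1, excSumAux g (walkBlocks E (N + 1)) [] (walkBlocks E m) =
      ∑ c ∈ Finset.range m, ((E.filter fun e => e.1 = c).map (eventWeight g)).sum := by
    intro m
    induction m with
    | zero => intro _; rfl
    | succ m ih =>
      intro hm
      have hmN : m ≤ N := by omega
      obtain ⟨suf, hsuf⟩ := exists_walkBlocks_append E hm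
      rw [show walkBlocks E (m + 1) = walkBlocks E m ++ walkBlock E m from rfl, excSumAux_append,
        ih (by omega), Finset.sum_range_succ]
      congr 1
      have h1 := excSumAux_block g (f := walkBlocks E (N + 1)) (pre := walkBlocks E m)
        (L := walkBlock E m) (suf := suf) (c := m) (by rw [hsuf, walkBlocks]) (hlen m (by omega))
        (by rw [h.length_walkBlock hmN, h.perm_walkBlocks.count_eq]) (walkBlock E m) [] rfl
      rw [List.append_nil] at h1
      rw [List.nil_append, h1, sum_eventWeight_filter]
      obtain ⟨B, hB, hF⟩ := h.exists_walkRuns_append_eq hmN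
      have h2 : gapSum g m ((walkBlocks E m).count m) 0 (B ++ [false]) =
          gapSum g m ((walkBlocks E m).count m) 0 B := by
        rw [gapSum_append]; simp [gapSum]
      rw [walkBlock, hB, weave_append_false _ _ _ hF,
        blockSum_weave _ _ _ _ _ _ hF fun s => ne_of_mem_walkExits, List.countP_nil, ← h2, ← hB,
        gapSum_append]
      have h3 := h.countP_lt_target hmN
      rw [← h.count_walkBlocks (by omega)] at h3
      -- With `s` copies of `m` in earlier blocks, the runs of status `false` contain `s + 1`
      -- entries `false`, one of them at the very end. Their copies of `m` thus follow at most `s`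
      -- exits, and those of status `true` follow at least `s + 1`.
      congr 2
      · rcases (h.walkRuns_eq_nil_or m false).2 with h4 | ⟨B', h4⟩
        · rw [h4] at h3; simp at h3
        · rw [h4] at h3 ⊢
          rw [gapSum_append, gapSum_of_le _ _ _ _ _ (by simp at h3; omega)]
          simp [gapSum]
      · rw [gapSum_of_lt _ _ _ _ _ (by omega)]
  exact key _ le_rfl

end IsWalk

/-- There is an injective rearrangement of words that keeps the first letter and
turns the excedances of the standardization into the letters that follow a larger one. -/
theorem exists_rearrangement (N : ℕ) : ∃ Φ : List ℕ → List ℕ,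
    (∀ Z, (∀ z ∈ Z, z ≤ N) → (Φ Z).Perm Z ∧ (Φ Z).head? = Z.head? ∧
      ∀ g, excSumAux g (Φ Z) [] (Φ Z) = walkSum g 0 false Z) ∧
    ∀ Z Z', (∀ z ∈ Z, z ≤ N) → (∀ z ∈ Z', z ≤ N) → Φ Z = Φ Z' → Z = Z' := by
  have hex : ∀ Z : List ℕ, ∃ E, (∀ z ∈ Z, z ≤ N) → IsWalk N 0 0 false Z E := by
    intro Z
    by_cases hZ : ∀ z ∈ Z, z ≤ N
    · obtain ⟨E, hE⟩ := IsWalk.exists_of_bounds N _ 0 0 false Z rfl (Nat.zero_le _)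
        (fun z hz => ⟨Nat.zero_le _, hZ z hz⟩) (Or.inl rfl)
      exact ⟨E, fun _ => hE⟩
    · exact ⟨[], fun h => absurd h hZ⟩
  choose E hE using hex
  refine ⟨fun Z => walkBlocks (E Z) (N + 1), fun Z hZ => ?_, fun Z Z' hZ hZ' h => ?_⟩
  · exact ⟨(hE Z hZ).perm_walkBlocks, (hE Z hZ).head?_walkBlocks rfl rfl,
      fun g => (hE Z hZ).excSumAux_walkBlocks g⟩
  · exact (hE Z hZ).eq_of_walkBlocks_eq (hE Z' hZ') h

/-! ### From words to increments -/

/-- The weight of an entry of a word on the alphabet `0 < -1 < 1 < -2 < 2 < ⋯`, encoded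
by `0, 1, 2, …`: negative letters have weight `1`, other letters have weight `2` if they are marked. -/
def letterWeight (t : ℕ) (e : Bool) : ℕ := if t % 2 = 1 then 1 else if e then 2 else 0

/-- The position in `[0, r]` that belongs to a letter and its mark. -/
def letterLevel (p : ℕ) (σ : Bool) : ℕ := (p + 1) / 2 + if p % 2 = 0 ∧ σ then 1 else 0

/-- The increments of the lattice path that a word describes. -/
def wordIncrements (r : ℕ) : ℕ → Bool → List ℕ → List ℕ
  | _, _, [] => []
  | p, σ, z :: Z =>
    (letterWeight z (if z = p then σ else decide (z < p)) * r +
      letterLevel z (if z = p then σ else decide (z < p)) - letterLevel p σ) ::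
      wordIncrements r z (if z = p then σ else decide (z < p)) Z

theorem increment_bounds {r p z : ℕ} {σ : Bool} (hp : letterLevel p σ ≤ r) (hz : z ≤ 2 * r) :
    letterLevel z (if z = p then σ else decide (z < p)) ≤ r ∧
    letterLevel p σ ≤ letterWeight z (if z = p then σ else decide (z < p)) * r +
      letterLevel z (if z = p then σ else decide (z < p)) ∧
    letterWeight z (if z = p then σ else decide (z < p)) * r +
      letterLevel z (if z = p then σ else decide (z < p)) ≤ 2 * r + letterLevel p σ := by
  unfold letterLevel letterWeight at *
  rcases lt_trichotomy z p with h | h | h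
  · rw [if_neg h.ne]
    rcases Nat.mod_two_eq_zero_or_one z with h2 | h2 <;>
      rcases Nat.mod_two_eq_zero_or_one p with h3 | h3 <;> cases σ <;>
      simp [h, h2, h3] at hp ⊢ <;> omega
  · subst h
    rcases Nat.mod_two_eq_zero_or_one z with h2 | h2 <;> cases σ <;>
      simp [h2] at hp ⊢ <;> omega
  · rw [if_neg h.ne']
    rcases Nat.mod_two_eq_zero_or_one z with h2 | h2 <;>
      rcases Nat.mod_two_eq_zero_or_one p with h3 | h3 <;> cases σ <;>
      simp [h.not_gt, h2, h3] at hp ⊢ <;> omega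

/-- With `ℓ` the level of `p` and `a` the absolute value of `y`, the three cases are negative,
unmarked and marked letters. For `y ≤ 2 * r` the heights lie in `[r + 1, 2 r]`, `[ℓ, r]` and `[2 r +
1, 2 r + ℓ]`; these are disjoint, and each case determines `a`, whence injectivity. -/
theorem increment_cases {r p y : ℕ} {σ : Bool} (hp : letterLevel p σ ≤ r) :
    ∃ a b : ℕ, y + b = 2 * a ∧ b ≤ 1 ∧
    ((b = 1 ∧ 1 ≤ a ∧ letterWeight y (if y = p then σ else decide (y < p)) * r +
      letterLevel y (if y = p then σ else decide (y < p)) = r + a) ∨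
    (b = 0 ∧ letterLevel p σ ≤ a ∧
      letterWeight y (if y = p then σ else decide (y < p)) * r +
      letterLevel y (if y = p then σ else decide (y < p)) = a) ∨
    (b = 0 ∧ a + 1 ≤ letterLevel p σ ∧
      letterWeight y (if y = p then σ else decide (y < p)) * r +
      letterLevel y (if y = p then σ else decide (y < p)) = 2 * r + a + 1)) := by
  refine ⟨(y + 1) / 2, y % 2, by omega, by omega, ?_⟩
  unfold letterLevel letterWeight at *
  rcases lt_trichotomy y p with h | h | h
  · rw [if_neg h.ne]
    rcases Nat.mod_two_eq_zero_or_one y with h2 | h2 <;>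
      rcases Nat.mod_two_eq_zero_or_one p with h3 | h3 <;> cases σ <;>
      simp [h, h2, h3] at hp ⊢ <;> omega
  · subst h
    rcases Nat.mod_two_eq_zero_or_one y with h2 | h2 <;> cases σ <;>
      simp [h2] at hp ⊢ <;> omega
  · rw [if_neg h.ne']
    rcases Nat.mod_two_eq_zero_or_one y with h2 | h2 <;>
      rcases Nat.mod_two_eq_zero_or_one p with h3 | h3 <;> cases σ <;>
      simp [h.not_gt, h2, h3] at hp ⊢ <;> omega

theorem increment_injective {r p z z' : ℕ} {σ : Bool} (hp : letterLevel p σ ≤ r) (hz : z ≤ 2 * r)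
    (hz' : z' ≤ 2 * r)
    (h : letterWeight z (if z = p then σ else decide (z < p)) * r +
      letterLevel z (if z = p then σ else decide (z < p)) =
      letterWeight z' (if z' = p then σ else decide (z' < p)) * r +
      letterLevel z' (if z' = p then σ else decide (z' < p))) : z = z' := by
  obtain ⟨a, b, h1, h2, h3⟩ := increment_cases (y := z) hp
  obtain ⟨a', b', h1', h2', h3'⟩ := increment_cases (y := z') hp
  omega

theorem length_wordIncrements (r : ℕ) (Z : List ℕ) : ∀ p σ,
    (wordIncrements r p σ Z).length = Z.length := by
  induction Z with
  | nil => simp [wordIncrements]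
  | cons z Z ih => simp [wordIncrements, ih]

theorem wordIncrements_le {r : ℕ} (Z : List ℕ) : ∀ p σ, letterLevel p σ ≤ r →
    (∀ z ∈ Z, z ≤ 2 * r) → ∀ d ∈ wordIncrements r p σ Z, d ≤ 2 * r := by
  induction Z with
  | nil => simp [wordIncrements]
  | cons z Z ih =>
    intro p σ hp hZ d hd
    have hb := increment_bounds hp (hZ z (by simp))
    rw [wordIncrements] at hd
    rcases List.mem_cons.1 hd with rfl | hd
    · omega
    · exact ih _ _ hb.1 (fun y hy => hZ y (by simp [hy])) d hd

theorem wordIncrements_injective {r : ℕ} (Z : List ℕ) : ∀ (Z' : List ℕ) (p : ℕ) (σ : Bool),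
    letterLevel p σ ≤ r → (∀ z ∈ Z, z ≤ 2 * r) → (∀ z ∈ Z', z ≤ 2 * r) →
    wordIncrements r p σ Z = wordIncrements r p σ Z' → Z = Z' := by
  induction Z with
  | nil =>
    intro Z' p σ _ _ _ h
    cases Z' with
    | nil => rfl
    | cons z Z' => simp [wordIncrements] at h
  | cons z Z ih =>
    intro Z' p σ hp hZ hZ' h
    cases Z' with
    | nil => simp [wordIncrements] at h
    | cons z' Z' =>
      rw [wordIncrements, wordIncrements] at h
      obtain ⟨h1, h2⟩ := List.cons.inj h
      have hb := increment_bounds hp (hZ z (by simp))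
      have hb' := increment_bounds hp (hZ' z' (by simp))
      have hz : z = z' := increment_injective hp (hZ z (by simp)) (hZ' z' (by simp)) (by omega)
      subst hz
      rw [ih Z' _ _ hb.1 (fun y hy => hZ y (by simp [hy])) (fun y hy => hZ' y (by simp [hy])) h2]

/-- The levels telescope, and `q` is the level of the last letter. Level 0 belongs only to an
unmarked `0`, and a positive level never returns to 0, so `q = 0` forces a word of unmarked zeros.
-/
theorem sum_wordIncrements {r : ℕ} (Z : List ℕ) : ∀ (p : ℕ) (σ : Bool), letterLevel p σ ≤ r →
    (∀ z ∈ Z, z ≤ 2 * r) →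
    ∃ q ≤ r, letterLevel p σ + (wordIncrements r p σ Z).sum = walkSum letterWeight p σ Z * r + q ∧
      (1 ≤ letterLevel p σ → 1 ≤ q) ∧
      (letterLevel p σ = 0 → q = 0 → walkSum letterWeight p σ Z = 0) := by
  induction Z with
  | nil => intro p σ hp _; exact ⟨_, hp, by simp [wordIncrements, walkSum], id, fun _ _ => rfl⟩
  | cons z Z ih =>
    intro p σ hp hZ
    have hb := increment_bounds hp (hZ z (by simp))
    obtain ⟨q, hq, h1, h2, h3⟩ := ih z (if z = p then σ else decide (z < p)) hb.1
      (fun y hy => hZ y (by simp [hy]))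
    refine ⟨q, hq, ?_, fun h => h2 ?_, fun h hq0 => ?_⟩
    · rw [wordIncrements, walkSum, List.sum_cons, add_mul]
      omega
    · unfold letterLevel at h ⊢
      rcases lt_trichotomy z p with h' | h' | h'
      · rw [if_neg h'.ne]
        rcases Nat.mod_two_eq_zero_or_one z with h4 | h4 <;> (simp [h', h4]; try omega)
      · rw [if_pos h', h']
        exact h
      · omega
    · have h4 : letterLevel z (if z = p then σ else decide (z < p)) = 0 := by omega
      rw [walkSum, h3 h4 hq0]
      unfold letterWeight letterLevel at *
      split_ifs at h4 ⊢ <;> first | omega | simp_all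

/-- The words of length `n` on the signed alphabet of size `2 r + 1` with nonnegative first letter. -/
def signedWords (r n : ℕ) : Set (List ℕ) :=
  {Z | Z.length = n ∧ (∀ z ∈ Z, z ≤ 2 * r) ∧ ∀ z ∈ Z.head?, z % 2 = 0}

/-- The lists of length `n` with entries in `[0, 2 r]`, the first of which is in `[0, r]`. -/
def incrementLists (r n : ℕ) : Set (List ℕ) :=
  {Z | Z.length = n ∧ (∀ z ∈ Z, z ≤ 2 * r) ∧ ∀ z ∈ Z.head?, z ≤ r}

theorem finite_lists_le (N n : ℕ) : {Z : List ℕ | Z.length = n ∧ ∀ z ∈ Z, z ≤ N}.Finite := by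
  refine (Set.finite_range fun v : Fin n → Fin (N + 1) => List.ofFn fun i => (v i : ℕ)).subset ?_
  rintro Z ⟨rfl, hZ⟩
  exact ⟨fun i => ⟨Z[i], Nat.lt_succ_of_le (hZ _ (by simp))⟩, by simp⟩

theorem finite_signedWords (r n : ℕ) : (signedWords r n).Finite :=
  (finite_lists_le (2 * r) n).subset fun _ h => ⟨h.1, h.2.1⟩

theorem finite_incrementLists (r n : ℕ) : (incrementLists r n).Finite :=
  (finite_lists_le (2 * r) n).subset fun _ h => ⟨h.1, h.2.1⟩

/-- This inequality upgrades the injection `wordIncrements` to a bijection. Doubling matches `[0,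
r]` with the even codes, those of the nonnegative letters. -/
theorem ncard_incrementLists_le (r n : ℕ) :
    (incrementLists r n).ncard ≤ (signedWords r n).ncard := by
  refine Set.ncard_le_ncard_of_injOn (List.modifyHead fun z => 2 * z) ?_ ?_
    (finite_signedWords r n)
  · rintro Z ⟨h1, h2, h3⟩
    cases Z with
    | nil => exact ⟨by simpa using h1, by simp, by simp⟩
    | cons z Z =>
      have hz : z ≤ r := h3 z (by simp)
      refine ⟨by simpa using h1, fun y hy => ?_, by simp⟩
      rcases List.mem_cons.1 (by simpa using hy) with rfl | hy
      · omega
      · exact h2 y (by simp [hy])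
  · intro Z _ Z' _ h
    cases Z <;> cases Z' <;> simp_all

theorem ncard_sep_eq_of_injOn {α β : Type*} {S : Set α} {T : Set β} (hT : T.Finite)
    (hcard : T.ncard ≤ S.ncard) {Φ : α → β} (hΦ : Set.MapsTo Φ S T) (hinj : Set.InjOn Φ S)
    {p : α → Prop} {q : β → Prop} (h : ∀ x ∈ S, p x ↔ q (Φ x)) :
    {x ∈ S | p x}.ncard = {y ∈ T | q y}.ncard := by
  have himg : Φ '' S = T :=
    Set.eq_of_subset_of_ncard_le hΦ.image_subset (by rwa [hinj.ncard_image]) hT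
  rw [← (hinj.mono (Set.sep_subset S p)).ncard_image]
  congr 1
  ext y
  constructor
  · rintro ⟨x, ⟨hx, hp⟩, rfl⟩
    exact ⟨hΦ hx, (h x hx).1 hp⟩
  · rintro ⟨hy, hq⟩
    rw [← himg] at hy
    obtain ⟨x, hx, rfl⟩ := hy
    exact ⟨x, ⟨hx, (h x hx).2 hq⟩, rfl⟩

theorem ncard_signedWords_excSum (r n j : ℕ) :
    {f ∈ signedWords r n | excSumAux letterWeight f [] f = j}.ncard =
      {Z ∈ signedWords r n | walkSum letterWeight 0 false Z = j}.ncard := by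
  obtain ⟨Φ, h1, h2⟩ := exists_rearrangement (2 * r)
  refine (ncard_sep_eq_of_injOn (finite_signedWords r n) le_rfl (Φ := Φ) ?_ ?_ ?_).symm
  · intro Z hZ
    obtain ⟨hp, hh, -⟩ := h1 Z hZ.2.1
    exact ⟨hp.length_eq.trans hZ.1, fun z hz => hZ.2.1 z (hp.mem_iff.1 hz), hh ▸ hZ.2.2⟩
  · intro Z hZ Z' hZ' h
    exact h2 Z Z' hZ.2.1 hZ'.2.1 h
  · intro Z hZ
    rw [(h1 Z hZ.2.1).2.2]

theorem ncard_signedWords_eq_ncard_incrementLists {r k : ℕ} (hk : 1 ≤ k) (n : ℕ) :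
    {f ∈ signedWords r n | excSumAux letterWeight f [] f = k - 1}.ncard =
      {d ∈ incrementLists r n | (k ≠ 1 → (k - 1) * r < d.sum) ∧ d.sum ≤ k * r}.ncard := by
  rw [ncard_signedWords_excSum]
  have h0 : letterLevel 0 false = 0 := by simp [letterLevel]
  refine ncard_sep_eq_of_injOn (finite_incrementLists r n) (ncard_incrementLists_le r n)
    (Φ := wordIncrements r 0 false) ?_ ?_ ?_
  · rintro Z ⟨hZ1, hZ2, hZ3⟩
    refine ⟨by rw [length_wordIncrements, hZ1], wordIncrements_le Z 0 false (by simp [h0]) hZ2, ?_⟩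
    cases Z with
    | nil => simp [wordIncrements]
    | cons z Z =>
      have hz := hZ3 z (by simp)
      have hz' := hZ2 z (by simp)
      simp [wordIncrements, letterWeight, letterLevel, hz]
      omega
  · intro Z hZ Z' hZ' h
    exact wordIncrements_injective Z Z' 0 false (by simp [h0]) hZ.2.1 hZ'.2.1 h
  · intro Z hZ
    obtain ⟨q, hq, h1, -, h2⟩ := sum_wordIncrements Z 0 false (by simp [h0]) hZ.2.1
    have h3 := h2 h0
    rw [h0, zero_add] at h1
    rw [h1]
    obtain ⟨k, rfl⟩ : ∃ j, k = j + 1 := ⟨k - 1, by omega⟩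
    generalize walkSum letterWeight 0 false Z = m at *
    simp only [Nat.add_sub_cancel, ne_eq, Nat.add_eq_right]
    constructor
    · rintro rfl
      refine ⟨fun hm => ?_, by rw [add_mul]; omega⟩
      have : q ≠ 0 := fun h => hm (h3 h)
      omega
    · rintro ⟨h4, h5⟩
      -- If `m > k`, the upper bound leaves `q = 0`, which is possible only for `m = 0`.
      have h6 : m ≤ k := by
        by_contra hlt
        have h7 : (k + 1) * r ≤ m * r := Nat.mul_le_mul_right r (by omega)
        have : q = 0 := by omega
        have := h3 this
        omega
      rcases eq_or_ne k 0 with rfl | hk0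
      · omega
      · have h4 := h4 hk0
        by_contra hne
        have h7 : (m + 1) * r ≤ k * r := Nat.mul_le_mul_right r (by omega)
        rw [add_mul] at h7
        omega

/-! ### Signed permutations as permutations with signs -/

theorem mem_signedRange {n : ℕ} {x : ℤ} :
    x ∈ signedRange n ↔ x ≠ 0 ∧ -(n : ℤ) ≤ x ∧ x ≤ n := by
  simp [signedRange]

theorem signedEntry_of_mem {n : ℕ} (w : signedPerms n) {x : ℤ} (h : x ∈ signedRange n) :
    signedEntry w x = (w.1 ⟨x, h⟩ : ℤ) := by
  rw [signedEntry, dif_pos h]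

theorem coe_signedRange_neg {n : ℕ} (x : signedRange n) : ((-x : signedRange n) : ℤ) = -(x : ℤ) :=
  rfl

theorem signedEntry_neg {n : ℕ} (w : signedPerms n) {x : ℤ} (h : x ∈ signedRange n) :
    signedEntry w (-x) = -signedEntry w x := by
  have h' : -x ∈ signedRange n := (-(⟨x, h⟩ : signedRange n)).2
  rw [signedEntry_of_mem w h, signedEntry_of_mem w h', ← coe_signedRange_neg]
  congr 1
  exact w.2 ⟨x, h⟩

theorem succ_mem_signedRange {n : ℕ} (i : Fin n) : (i : ℤ) + 1 ∈ signedRange n := by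
  have := i.2
  rw [mem_signedRange]; omega

theorem signedPerms_ext {n : ℕ} {w w' : signedPerms n}
    (h : ∀ i : Fin n, signedEntry w ((i : ℤ) + 1) = signedEntry w' ((i : ℤ) + 1)) : w = w' := by
  have key : ∀ x, x ∈ signedRange n → 0 < x → signedEntry w x = signedEntry w' x := by
    intro x hx hpos
    have hx' := mem_signedRange.1 hx
    have := h ⟨(x - 1).toNat, by omega⟩
    rwa [show (((⟨(x - 1).toNat, by omega⟩ : Fin n) : ℕ) : ℤ) + 1 = x by simp; omega] at this
  apply Subtype.ext
  apply Equiv.ext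
  rintro ⟨x, hx⟩
  apply Subtype.ext
  rw [← signedEntry_of_mem w hx, ← signedEntry_of_mem w' hx]
  rcases lt_or_gt_of_ne (mem_signedRange.1 hx).1 with h0 | h0
  · have hx' : -x ∈ signedRange n := (-(⟨x, hx⟩ : signedRange n)).2
    have := key (-x) hx' (by omega)
    rw [signedEntry_neg w hx, signedEntry_neg w' hx] at this
    omega
  · exact key x hx h0

theorem exists_perm_sign {n : ℕ} (w : signedPerms n) : ∃ (π : Equiv.Perm (Fin n)) (s : Fin n → Bool),
    ∀ i : Fin n, signedEntry w ((i : ℤ) + 1) = if s i then -((π i : ℤ) + 1) else (π i : ℤ) + 1 := by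
  have hmem : ∀ i : Fin n, signedEntry w ((i : ℤ) + 1) ∈ signedRange n := fun i => by
    rw [signedEntry_of_mem w (succ_mem_signedRange i)]
    exact Subtype.prop _
  have hb := fun i => mem_signedRange.1 (hmem i)
  let φ : Fin n → Fin n := fun i => ⟨(signedEntry w ((i : ℤ) + 1)).natAbs - 1, by
    have := hb i; omega⟩
  have hinj : Function.Injective φ := by
    intro i j hij
    have hij' : (signedEntry w ((i : ℤ) + 1)).natAbs - 1 =
      (signedEntry w ((j : ℤ) + 1)).natAbs - 1 := congrArg Fin.val hij
    have h1 := hb i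
    have h2 := hb j
    have h3 : signedEntry w ((i : ℤ) + 1) = signedEntry w ((j : ℤ) + 1) ∨
        signedEntry w ((i : ℤ) + 1) = signedEntry w (-((j : ℤ) + 1)) := by
      rw [signedEntry_neg w (succ_mem_signedRange j)]; omega
    have hinj' : ∀ {x y : ℤ} (hx : x ∈ signedRange n) (hy : y ∈ signedRange n),
        signedEntry w x = signedEntry w y → x = y := by
      intro x y hx hy h
      rw [signedEntry_of_mem w hx, signedEntry_of_mem w hy] at h
      exact congrArg Subtype.val (w.1.injective (Subtype.ext h))
    rcases h3 with h3 | h3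
    · have := hinj' (succ_mem_signedRange i) (succ_mem_signedRange j) h3
      exact Fin.ext (by omega)
    · have := hinj' (succ_mem_signedRange i)
        (-(⟨_, succ_mem_signedRange j⟩ : signedRange n)).2 h3
      rw [coe_signedRange_neg] at this
      simp only at this
      omega
  refine ⟨Equiv.ofBijective φ (Finite.injective_iff_bijective.1 hinj),
    fun i => decide (signedEntry w ((i : ℤ) + 1) < 0), fun i => ?_⟩
  have h1 := hb i
  have h2 : ((Equiv.ofBijective φ (Finite.injective_iff_bijective.1 hinj) i : Fin n) : ℕ) =
    (signedEntry w ((i : ℤ) + 1)).natAbs - 1 := rfl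
  rw [h2]
  split_ifs with h <;> simp at h <;> omega

/-- The permutation `i ↦ |w_i|` of a signed permutation `w`, on `Fin n`. -/
noncomputable def absPerm {n : ℕ} (w : signedPerms n) : Equiv.Perm (Fin n) :=
  (exists_perm_sign w).choose

/-- Whether `w_i` is negative. -/
noncomputable def signOf {n : ℕ} (w : signedPerms n) : Fin n → Bool :=
  (exists_perm_sign w).choose_spec.choose

theorem signedEntry_eq {n : ℕ} (w : signedPerms n) (i : Fin n) :
    signedEntry w ((i : ℤ) + 1) =
      if signOf w i then -((absPerm w i : ℤ) + 1) else (absPerm w i : ℤ) + 1 :=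
  (exists_perm_sign w).choose_spec.choose_spec i

theorem exists_signedPerm {n : ℕ} (π : Equiv.Perm (Fin n)) (s : Fin n → Bool) :
    ∃ w : signedPerms n, absPerm w = π ∧ signOf w = s := by
  have hidx : ∀ x : signedRange n, (x : ℤ).natAbs - 1 < n := fun x => by
    have := mem_signedRange.1 x.2; omega
  let idx : signedRange n → Fin n := fun x => ⟨(x : ℤ).natAbs - 1, hidx x⟩
  let val : signedRange n → ℤ := fun x =>
    if (decide ((x : ℤ) < 0)) = s (idx x) then (π (idx x) : ℤ) + 1 else -((π (idx x) : ℤ) + 1)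
  have hval : ∀ x, val x ∈ signedRange n := fun x => by
    have := (π (idx x)).2
    rw [mem_signedRange]
    simp only [val]
    split_ifs <;> omega
  let φ : signedRange n → signedRange n := fun x => ⟨val x, hval x⟩
  have hinj : Function.Injective φ := by
    intro x y hxy
    have hxy' : val x = val y := congrArg Subtype.val hxy
    have h1 := mem_signedRange.1 x.2
    have h2 := mem_signedRange.1 y.2
    have h3 : π (idx x) = π (idx y) := by
      apply Fin.ext
      simp only [val] at hxy'
      split_ifs at hxy' <;> omega
    have h4 : idx x = idx y := π.injective h3
    have h5 : decide ((x : ℤ) < 0) = decide ((y : ℤ) < 0) := by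
      simp only [val, h4] at hxy'
      by_cases ha : decide ((x : ℤ) < 0) = s (idx y) <;>
        by_cases hb : decide ((y : ℤ) < 0) = s (idx y)
      · rw [ha, hb]
      · rw [if_pos ha, if_neg hb] at hxy'; omega
      · rw [if_neg ha, if_pos hb] at hxy'; omega
      · cases hs : s (idx y) <;> simp [hs] at ha hb <;> simp <;> omega
    have h6 : (x : ℤ).natAbs - 1 = (y : ℤ).natAbs - 1 := congrArg Fin.val h4
    have h7 : (x : ℤ) < 0 ↔ (y : ℤ) < 0 := by simpa using h5
    apply Subtype.ext
    omega
  let e : Equiv.Perm (signedRange n) :=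
    Equiv.ofBijective φ (Finite.injective_iff_bijective.1 hinj)
  have he : ∀ x, (e x : ℤ) = val x := fun _ => rfl
  have hneg : e ∈ signedPerms n := by
    intro x
    apply Subtype.ext
    rw [coe_signedRange_neg, he, he]
    have h1 := mem_signedRange.1 x.2
    have h2 : idx (-x) = idx x := by
      apply Fin.ext
      change (-(x : ℤ)).natAbs - 1 = (x : ℤ).natAbs - 1
      rw [Int.natAbs_neg]
    simp only [val, h2, coe_signedRange_neg]
    rcases lt_or_gt_of_ne h1.1 with h | h
    · cases s (idx x) <;> simp [h] <;> omega
    · cases s (idx x) <;> simp [h.not_gt] <;> omega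
  have hent : ∀ i : Fin n, signedEntry (⟨e, hneg⟩ : signedPerms n) ((i : ℤ) + 1) =
      if s i then -((π i : ℤ) + 1) else (π i : ℤ) + 1 := by
    intro i
    rw [signedEntry_of_mem _ (succ_mem_signedRange i)]
    change val ⟨(i : ℤ) + 1, _⟩ = _
    have h1 : idx ⟨(i : ℤ) + 1, succ_mem_signedRange i⟩ = i := by
      apply Fin.ext
      change ((i : ℤ) + 1).natAbs - 1 = i
      omega
    have h2 : ¬ (i : ℤ) + 1 < 0 := by omega
    simp only [val, h1, h2, decide_false]
    cases s i <;> simp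
  refine ⟨⟨e, hneg⟩, Equiv.ext fun i => ?_, funext fun i => ?_⟩
  · have h1 := signedEntry_eq (⟨e, hneg⟩ : signedPerms n) i
    rw [hent] at h1
    apply Fin.ext
    split_ifs at h1 <;> omega
  · have h1 := signedEntry_eq (⟨e, hneg⟩ : signedPerms n) i
    rw [hent] at h1
    generalize signOf (⟨e, hneg⟩ : signedPerms n) i = b at *
    cases b <;> cases h2 : s i <;> simp [h2] at h1 ⊢ <;> omega

theorem eq_of_absPerm_eq {n : ℕ} {w w' : signedPerms n} (h : absPerm w = absPerm w')
    (h' : signOf w = signOf w') : w = w' :=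
  signedPerms_ext fun i => by rw [signedEntry_eq, signedEntry_eq, h, h']

theorem card_filter_Icc_one {n : ℕ} (p : ℤ → Prop) [DecidablePred p] :
    ((Finset.Icc (1 : ℤ) n).filter p).card =
      (Finset.univ.filter fun i : Fin n => p ((i : ℤ) + 1)).card := by
  symm
  refine Finset.card_bij (fun i _ => (i : ℤ) + 1) ?_ ?_ ?_
  · intro i hi
    have := i.2
    simp at hi ⊢
    exact hi
  · intro i _ j _ h
    exact Fin.ext (by omega)
  · intro x hx
    simp at hx
    have h : (((x - 1).toNat : ℕ) : ℤ) + 1 = x := by omega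
    refine ⟨⟨(x - 1).toNat, by omega⟩, Finset.mem_filter.2 ⟨Finset.mem_univ _, ?_⟩, h⟩
    change p (((x - 1).toNat : ℤ) + 1)
    rw [h]
    exact hx.2

theorem fexc_eq_sum {n : ℕ} (w : signedPerms n) :
    fexc w = ∑ i : Fin n, if signOf w i then 1 else if i < absPerm w i then 2 else 0 := by
  rw [fexc, signedExc, signedNeg, card_filter_Icc_one, card_filter_Icc_one, Finset.card_filter,
    Finset.card_filter, Finset.mul_sum, ← Finset.sum_add_distrib]
  refine Finset.sum_congr rfl fun i _ => ?_
  rw [signedEntry_eq]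
  generalize absPerm w i = j
  have h1 : (j : ℤ) + 1 > (i : ℤ) + 1 ↔ i < j := by
    rw [Fin.lt_def]; omega
  have h2 : ¬ (j : ℤ) + 1 < 0 := by omega
  have h3 : ¬ -((j : ℤ) + 1) > (i : ℤ) + 1 := by omega
  have h4 : -((j : ℤ) + 1) < 0 := by omega
  cases signOf w i
  · simp only [Bool.false_eq_true, if_false, h1, if_neg h2]
    split_ifs <;> rfl
  · simp only [if_true, if_neg h3, if_pos h4, mul_zero, zero_add]

theorem desB_eq_sum {n : ℕ} (w : signedPerms n) :
    desB w = ∑ i : Fin n, if signedEntry w (i : ℤ) > signedEntry w ((i : ℤ) + 1) then 1 else 0 := by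
  rw [desB, ← Finset.card_filter]
  symm
  refine Finset.card_bij (fun i _ => (i : ℤ)) ?_ ?_ ?_
  · intro i hi
    have := i.2
    simp at hi ⊢
    exact hi
  · intro i _ j _ h
    exact Fin.ext (by omega)
  · intro x hx
    simp at hx
    have h : ((x.toNat : ℕ) : ℤ) = x := by omega
    exact ⟨⟨x.toNat, by omega⟩, by simp [h, hx.2], h⟩

theorem mem_setX_iff {n : ℕ} (w : signedPerms n) (i : Fin n) (hi : (absPerm w i : ℕ) = 0) :
    w ∈ setX n ↔ signOf w i = false := by
  have hmem := succ_mem_signedRange i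
  have h1 : (1 : ℤ) ∈ signedRange n := by
    have := i.2
    rw [mem_signedRange]; omega
  have he := signedEntry_eq w i
  rw [hi, signedEntry_of_mem w hmem] at he
  rw [setX, Finset.mem_filter, signedEntry_of_mem _ h1]
  simp only [Finset.mem_univ, true_and]
  have hinv : ∀ x y : signedRange n, w.1 x = y → (w⁻¹).1 y = x := by
    rintro x y rfl
    simp
  cases hs : signOf w i
  · have h2 : w.1 ⟨_, hmem⟩ = ⟨1, h1⟩ := Subtype.ext (by rw [he, hs]; simp)
    rw [hinv _ _ h2]
    simp
  · have h2 : w.1 (-⟨_, hmem⟩) = ⟨1, h1⟩ := by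
      rw [w.2]
      apply Subtype.ext
      rw [coe_signedRange_neg, he, hs]; simp
    rw [hinv _ _ h2, coe_signedRange_neg]
    simp

/-! ### Standardization of words -/

/-- The sort key of a position of a word on the alphabet `0 < -1 < 1 < -2 < 2 < ⋯`. -/
def sortKey {n : ℕ} (f : Fin n → ℕ) (j : Fin n) : ℕ ×ₗ ℤ :=
  toLex ((f j + 1) / 2, if f j % 2 = 1 then -((j : ℤ) + 1) else (j : ℤ) + 1)

/-- `w` is the standardization of the word `f`. -/
def IsStandardization {n : ℕ} (w : signedPerms n) (f : Fin n → ℕ) : Prop :=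
  (∀ i, signOf w i = decide (f (absPerm w i) % 2 = 1)) ∧
    StrictMono fun i => sortKey f (absPerm w i)

theorem sortKey_injective {n : ℕ} (f : Fin n → ℕ) : Function.Injective (sortKey f) := by
  intro i j h
  have h2 : (if f i % 2 = 1 then -((i : ℤ) + 1) else (i : ℤ) + 1) =
    if f j % 2 = 1 then -((j : ℤ) + 1) else (j : ℤ) + 1 := congrArg (fun x => (ofLex x).2) h
  apply Fin.ext
  split_ifs at h2 <;> omega

theorem exists_isStandardization {n : ℕ} (f : Fin n → ℕ) : ∃ w, IsStandardization w f := by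
  obtain ⟨w, hw, hs⟩ := exists_signedPerm (Tuple.sort (sortKey f))
    (fun i => decide (f (Tuple.sort (sortKey f) i) % 2 = 1))
  refine ⟨w, fun i => by rw [hs, hw], ?_⟩
  rw [hw]
  exact (Tuple.monotone_sort (sortKey f)).strictMono_of_injective
    ((sortKey_injective f).comp (Equiv.injective _))

theorem IsStandardization.unique {n : ℕ} {w w' : signedPerms n} {f : Fin n → ℕ}
    (h : IsStandardization w f) (h' : IsStandardization w' f) : w = w' := by
  have h1 := Tuple.unique_monotone (f := sortKey f) (σ := absPerm w) (τ := absPerm w') h.2.monotone h'.2.monotone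
  have h2 : absPerm w = absPerm w' :=
    Equiv.ext fun i => sortKey_injective f (congrFun h1 i)
  exact eq_of_absPerm_eq h2 (funext fun i => by rw [h.1, h'.1, h2])

theorem sortKey_absPerm {n : ℕ} {w : signedPerms n} {f : Fin n → ℕ}
    (h : ∀ i, signOf w i = decide (f (absPerm w i) % 2 = 1)) (i : Fin n) :
    sortKey f (absPerm w i) =
      toLex ((f (absPerm w i) + 1) / 2, signedEntry w ((i : ℤ) + 1)) := by
  rw [sortKey, signedEntry_eq, h i]
  simp

/-- Equal negative letters are sorted from right to left, so the usual left-to-right rank is right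
only at nonnegative letters. This suffices, as `letterWeight` ignores the mark of negative ones. -/
theorem sortKey_lt_of_even {n : ℕ} {f : Fin n → ℕ} {j : Fin n} (hj : f j % 2 = 0) (i : Fin n) :
    sortKey f i < sortKey f j ↔ f i < f j ∨ (f i = f j ∧ i < j) := by
  rw [sortKey, sortKey, Prod.Lex.toLex_lt_toLex]
  simp only [hj, Fin.lt_def]
  rcases Nat.mod_two_eq_zero_or_one (f i) with h | h <;> simp [h] <;> omega

theorem card_sortKey_lt {n : ℕ} {w : signedPerms n} {f : Fin n → ℕ} (h : IsStandardization w f)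
    (i : Fin n) :
    (Finset.univ.filter fun j => sortKey f j < sortKey f (absPerm w i)).card = i := by
  have : (Finset.univ.filter fun j => sortKey f j < sortKey f (absPerm w i)) =
      (Finset.Iio i).map (absPerm w).toEmbedding := by
    ext j
    obtain ⟨j, rfl⟩ := (absPerm w).surjective j
    have := h.2.lt_iff_lt (a := j) (b := i)
    simp [this]
  rw [this, Finset.card_map, Fin.card_Iio]

theorem countP_ofFn {n : ℕ} (f : Fin n → ℕ) (p : ℕ → Bool) :
    (List.ofFn f).countP p = (Finset.univ.filter fun i => p (f i) = true).card := by
  induction n with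
  | zero => simp
  | succ n ih =>
    rw [List.ofFn_succ, List.countP_cons, ih, Finset.card_filter, Finset.card_filter,
      Fin.sum_univ_succ, add_comm]

theorem count_take_ofFn {n : ℕ} (f : Fin n → ℕ) (t m : ℕ) :
    ((List.ofFn f).take m).count t =
      (Finset.univ.filter fun i : Fin n => f i = t ∧ (i : ℕ) < m).card := by
  induction n generalizing m with
  | zero => simp
  | succ n ih =>
    cases m with
    | zero => simp
    | succ m =>
      rw [List.ofFn_succ, List.take_succ_cons, List.count_cons, ih, Finset.card_filter,
        Finset.card_filter, Fin.sum_univ_succ, add_comm]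
      simp

theorem excSumAux_eq_sum (g : ℕ → Bool → ℕ) (f : List ℕ) (l : List ℕ) : ∀ pre,
    excSumAux g f pre l = ∑ j : Fin l.length, g l[j]
      (decide (f.countP (fun x => x < l[j]) + (pre ++ l.take j).count l[j] < pre.length + j)) := by
  induction l with
  | nil => intro pre; rfl
  | cons t l ih =>
    intro pre
    rw [excSumAux, ih]
    refine Eq.trans ?_ (Fin.sum_univ_succ (M := ℕ) (n := l.length) _).symm
    congr 1
    · simp
      rfl
    refine Finset.sum_congr rfl fun j _ => ?_
    simp [add_assoc, add_comm 1]

theorem excSumAux_ofFn (g : ℕ → Bool → ℕ) {n : ℕ} (f : Fin n → ℕ) :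
    excSumAux g (List.ofFn f) [] (List.ofFn f) = ∑ j : Fin n, g (f j)
      (decide ((Finset.univ.filter fun i => f i < f j ∨ (f i = f j ∧ i < j)).card < j)) := by
  rw [excSumAux_eq_sum, ← (finCongr (List.length_ofFn (f := f))).sum_comp fun j : Fin n => g (f j)
    (decide ((Finset.univ.filter fun i => f i < f j ∨ (f i = f j ∧ i < j)).card < j))]
  refine Finset.sum_congr rfl fun j _ => ?_
  have h1 : (List.ofFn f)[j] = f (finCongr (List.length_ofFn (f := f)) j) := by simp; rfl
  rw [h1, List.nil_append, countP_ofFn, count_take_ofFn, Finset.filter_or,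
    Finset.card_union_of_disjoint]
  · simp [Fin.lt_def]
  · rw [Finset.disjoint_filter]
    intro i _ h2 h3
    omega

/-- The letter at position `|w_i|` has rank `i`, so at a nonnegative letter an excedance of the
word, rank less than position, is `w_i > i`. -/
theorem excSum_eq_fexc {n : ℕ} {w : signedPerms n} {f : Fin n → ℕ} (h : IsStandardization w f) :
    excSumAux letterWeight (List.ofFn f) [] (List.ofFn f) = fexc w := by
  rw [excSumAux_ofFn, fexc_eq_sum, ← Equiv.sum_comp (absPerm w)]
  refine Finset.sum_congr rfl fun i _ => ?_
  rw [h.1 i, letterWeight]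
  rcases Nat.mod_two_eq_zero_or_one (f (absPerm w i)) with h1 | h1
  · have h2 := card_sortKey_lt h i
    simp only [sortKey_lt_of_even h1] at h2
    rw [h2]
    simp [h1]
  · simp [h1]

theorem even_iff_mem_setX {n : ℕ} {w : signedPerms n} {f : Fin n → ℕ} (h : IsStandardization w f)
    (hn : 1 ≤ n) : (∀ z ∈ (List.ofFn f).head?, z % 2 = 0) ↔ w ∈ setX n := by
  obtain ⟨m, rfl⟩ : ∃ m, n = m + 1 := ⟨n - 1, by omega⟩
  rw [mem_setX_iff w ((absPerm w).symm 0) (by simp), h.1]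
  simp [List.ofFn_succ]

/-! ### Counting the words with a given standardization -/

theorem exists_chain_finset (n : ℕ) (δ : Fin n → ℕ) (v r : ℕ) : ∃ S : Finset (Fin n → ℕ), ∀ b,
    b ∈ S ↔ ∀ i : Fin n, (Fin.cons v b : Fin (n + 1) → ℕ) i.castSucc + δ i ≤ b i ∧ b i ≤ r := by
  classical
  refine ⟨(Fintype.piFinset fun _ => Finset.range (r + 1)).filter fun b =>
    ∀ i : Fin n, (Fin.cons v b : Fin (n + 1) → ℕ) i.castSucc + δ i ≤ b i ∧ b i ≤ r, fun b => ?_⟩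
  rw [Finset.mem_filter, and_iff_right_iff_imp]
  intro h
  simp only [Fintype.mem_piFinset, Finset.mem_range]
  exact fun i => Nat.lt_succ_of_le (h i).2

/-- The sequences `v ≤ b_0 ≤ b_1 ≤ ⋯ ≤ r` with gaps bounded from below by `δ`. -/
noncomputable def chainFinset (n : ℕ) (δ : Fin n → ℕ) (v r : ℕ) : Finset (Fin n → ℕ) :=
  (exists_chain_finset n δ v r).choose

theorem mem_chainFinset {n : ℕ} {δ : Fin n → ℕ} {v r : ℕ} {b : Fin n → ℕ} :
    b ∈ chainFinset n δ v r ↔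
      ∀ i : Fin n, (Fin.cons v b : Fin (n + 1) → ℕ) i.castSucc + δ i ≤ b i ∧ b i ≤ r :=
  (exists_chain_finset n δ v r).choose_spec b

theorem card_chainFinset_succ (n : ℕ) (δ : Fin (n + 1) → ℕ) (v r : ℕ) :
    (chainFinset (n + 1) δ v r).card =
      ∑ x ∈ Finset.Icc (v + δ 0) r, (chainFinset n (fun i => δ i.succ) x r).card := by
  classical
  rw [Finset.card_eq_sum_card_fiberwise (f := fun b => b 0) (t := Finset.Icc (v + δ 0) r)]
  · refine Finset.sum_congr rfl fun x hx => ?_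
    rw [Finset.mem_Icc] at hx
    refine Finset.card_bij (fun b _ => Fin.tail b) ?_ ?_ ?_
    · intro b hb
      obtain ⟨hb', rfl⟩ := Finset.mem_filter.1 hb
      replace hb := hb'
      rw [mem_chainFinset] at hb ⊢
      intro i
      have := hb i.succ
      rw [Fin.castSucc_succ, Fin.cons_succ] at this
      rw [Fin.cons_self_tail]
      exact this
    · intro b hb b' hb' h
      rw [← Fin.cons_self_tail b, ← Fin.cons_self_tail b', h, (Finset.mem_filter.1 hb).2,
        (Finset.mem_filter.1 hb').2]
    · intro b hb
      rw [mem_chainFinset] at hb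
      refine ⟨Fin.cons x b, ?_, Fin.tail_cons _ _⟩
      rw [Finset.mem_filter, mem_chainFinset]
      refine ⟨fun i => ?_, by simp⟩
      refine Fin.cases ?_ (fun i => ?_) i
      · simpa using hx
      · rw [Fin.castSucc_succ, Fin.cons_succ, Fin.cons_succ]
        exact hb i
  · intro b hb
    have hb' := mem_chainFinset.1 (Finset.mem_coe.1 hb) 0
    simpa using hb'

/-- Translation invariance makes the sum over the first entry a convolution, hence a product of
power series. -/
theorem card_chainFinset_add (n : ℕ) : ∀ (δ : Fin n → ℕ) (v r a : ℕ),
    (chainFinset n δ (v + a) (r + a)).card = (chainFinset n δ v r).card := by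
  induction n with
  | zero =>
    intro δ v r a
    congr 1
    ext b
    simp [mem_chainFinset]
  | succ n ih =>
    intro δ v r a
    rw [card_chainFinset_succ, card_chainFinset_succ, add_right_comm,
      ← Finset.image_add_right_Icc, Finset.sum_image (by simp)]
    exact Finset.sum_congr rfl fun x _ => ih _ _ _ _

theorem mk_card_chainFinset (n : ℕ) : ∀ δ : Fin n → ℕ,
    PowerSeries.mk (fun r => ((chainFinset n δ 0 r).card : ℚ)) * (1 - PowerSeries.X) ^ (n + 1) =
      PowerSeries.X ^ (∑ i, δ i) := by
  induction n with
  | zero =>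
    intro δ
    have h : ∀ r, chainFinset 0 δ 0 r = Finset.univ := fun r => by
      ext b
      rw [mem_chainFinset]
      exact ⟨fun _ => Finset.mem_univ _, fun _ i => i.elim0⟩
    simp only [h]
    simpa using! PowerSeries.mk_one_mul_one_sub_eq_one ℚ
  | succ n ih =>
    intro δ
    have h1 : PowerSeries.mk (fun r => ((chainFinset (n + 1) δ 0 r).card : ℚ)) =
        (PowerSeries.X ^ δ 0 * PowerSeries.mk 1) *
          PowerSeries.mk (fun r => ((chainFinset n (fun i => δ i.succ) 0 r).card : ℚ)) := by
      ext r
      rw [PowerSeries.coeff_mul, Finset.Nat.sum_antidiagonal_eq_sum_range_succ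
        (fun x y => PowerSeries.coeff x (PowerSeries.X ^ δ 0 * PowerSeries.mk (1 : ℕ → ℚ)) *
          PowerSeries.coeff y
            (PowerSeries.mk fun r => ((chainFinset n (fun i => δ i.succ) 0 r).card : ℚ))),
        PowerSeries.coeff_mk, card_chainFinset_succ, zero_add, Nat.cast_sum]
      have h2 : Finset.Icc (δ 0) r = (Finset.range (r + 1)).filter fun x => δ 0 ≤ x := by
        ext x
        simp; omega
      rw [h2, Finset.sum_filter]
      refine Finset.sum_congr rfl fun x hx => ?_
      have h3 := card_chainFinset_add n (fun i => δ i.succ) 0 (r - x) x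
      rw [zero_add, Nat.sub_add_cancel (Nat.lt_succ_iff.1 (Finset.mem_range.1 hx))] at h3
      rw [PowerSeries.coeff_X_pow_mul', PowerSeries.coeff_mk, h3]
      split_ifs <;> simp
    rw [h1, Fin.sum_univ_succ, pow_add (PowerSeries.X : PowerSeries ℚ), ← ih fun i => δ i.succ]
    have h4 := PowerSeries.mk_one_mul_one_sub_eq_one ℚ
    linear_combination (PowerSeries.X ^ δ 0 *
      PowerSeries.mk (fun r => ((chainFinset n (fun i => δ i.succ) 0 r).card : ℚ)) *
      (1 - PowerSeries.X) ^ (n + 1)) * h4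

/-- The indicator of the descents of a signed permutation. -/
noncomputable def descentIndicator {n : ℕ} (w : signedPerms n) (i : Fin n) : ℕ :=
  if signedEntry w (i : ℤ) > signedEntry w ((i : ℤ) + 1) then 1 else 0

theorem signedEntry_zero {n : ℕ} (w : signedPerms n) : signedEntry w 0 = 0 := by
  rw [signedEntry, dif_neg]
  simp [signedRange]

theorem signedEntry_neg_iff {n : ℕ} (w : signedPerms n) (i : Fin n) :
    signedEntry w ((i : ℤ) + 1) < 0 ↔ signOf w i = true := by
  rw [signedEntry_eq]
  cases signOf w i <;> simp <;> omega

theorem signedEntry_injective {n : ℕ} (w : signedPerms n) {i j : Fin n}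
    (h : signedEntry w ((i : ℤ) + 1) = signedEntry w ((j : ℤ) + 1)) : i = j := by
  rw [signedEntry_eq, signedEntry_eq] at h
  apply (absPerm w).injective
  apply Fin.ext
  split_ifs at h <;> omega

/-- A lexicographic increase of `(b_i, w_i)` is a weak increase of `b` that is strict at descents.
The descent at 0 gives `b_1 ≥ 1`; later negative entries either follow a negative entry or create a
descent. The condition on signs reflects that there is no letter `-0`. -/
theorem mem_chainFinset_descentIndicator {n : ℕ} (w : signedPerms n) (r : ℕ) (b : Fin n → ℕ) :
    b ∈ chainFinset n (descentIndicator w) 0 r ↔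
      (∀ i, b i ≤ r) ∧
        StrictMono (fun i => (toLex (b i, signedEntry w ((i : ℤ) + 1)) : ℕ ×ₗ ℤ)) ∧
        ∀ i, signOf w i = true → 1 ≤ b i := by
  rw [mem_chainFinset]
  cases n with
  | zero => simp [Subsingleton.strictMono]
  | succ n =>
    have h0 : descentIndicator w 0 = if signOf w 0 = true then 1 else 0 := by
      rw [descentIndicator]
      congr 1
      rw [← signedEntry_neg_iff]
      simp [signedEntry_zero]
    have hs : ∀ i : Fin n, descentIndicator w i.succ =
        if signedEntry w ((i.castSucc : ℤ) + 1) > signedEntry w ((i.succ : ℤ) + 1)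
          then 1 else 0 := by
      intro i
      rw [descentIndicator]
      simp
    rw [Fin.strictMono_iff_lt_succ, Fin.forall_fin_succ]
    simp only [Fin.castSucc_zero, Fin.cons_zero, Fin.castSucc_succ, Fin.cons_succ, zero_add, h0, hs,
      Prod.Lex.toLex_lt_toLex]
    constructor
    · rintro ⟨h1, h2⟩
      refine ⟨fun i => Fin.cases h1.2 (fun i => (h2 i).2) i, fun i => ?_, fun i => ?_⟩
      · have h3 := (h2 i).1
        have h4 : signedEntry w ((i.castSucc : ℤ) + 1) ≠ signedEntry w ((i.succ : ℤ) + 1) :=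
          fun h => by
            have := congrArg Fin.val (signedEntry_injective w h)
            simp at this
        split_ifs at h3 <;> omega
      · induction i using Fin.induction with
        | zero => intro h; rw [if_pos h] at h1; exact h1.1
        | succ i ih =>
          intro h
          have h3 := (h2 i).1
          by_cases hi : signOf w i.castSucc = true
          · have := ih hi; omega
          · rw [← signedEntry_neg_iff] at hi h
            rw [if_pos (by omega)] at h3
            omega
    · rintro ⟨h1, h2, h3⟩
      refine ⟨⟨?_, h1 0⟩, fun i => ⟨?_, h1 _⟩⟩
      · split_ifs with h
        · exact h3 0 h
        · exact Nat.zero_le _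
      · have := h2 i
        split_ifs <;> omega

theorem card_standardization_fiber {n : ℕ} (w : signedPerms n) (r : ℕ) (S : Finset (Fin n → ℕ))
    (hS : ∀ f, f ∈ S ↔ (∀ i, f i ≤ 2 * r) ∧ IsStandardization w f) :
    S.card = (chainFinset n (descentIndicator w) 0 r).card := by
  refine Finset.card_bij (fun f _ i => (f (absPerm w i) + 1) / 2) ?_ ?_ ?_
  · intro f hf
    obtain ⟨h1, h2, h3⟩ := (hS f).1 hf
    rw [mem_chainFinset_descentIndicator]
    refine ⟨fun i => ?_, ?_, fun i hi => ?_⟩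
    · have := h1 (absPerm w i); omega
    · simpa only [sortKey_absPerm h2] using h3
    · rw [h2] at hi
      simp at hi; omega
  · intro f hf f' hf' h
    obtain ⟨-, h2, -⟩ := (hS f).1 hf
    obtain ⟨-, h2', -⟩ := (hS f').1 hf'
    funext j
    obtain ⟨i, rfl⟩ := (absPerm w).surjective j
    have h3 : (f (absPerm w i) + 1) / 2 = (f' (absPerm w i) + 1) / 2 := congrFun h i
    have h4 := (h2 i).symm.trans (h2' i)
    rw [decide_eq_decide] at h4
    omega
  · intro b hb
    rw [mem_chainFinset_descentIndicator] at hb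
    obtain ⟨h1, h2, h3⟩ := hb
    -- The code of the letter with absolute value `b` and the sign given by `w`; the subtraction
    -- does not truncate, since `b ≥ 1` at negative entries.
    let f : Fin n → ℕ := fun j => 2 * b ((absPerm w).symm j) -
      if signOf w ((absPerm w).symm j) = true then 1 else 0
    have hf : ∀ i, f (absPerm w i) = 2 * b i - if signOf w i = true then 1 else 0 := by
      intro i; simp [f]
    have hsgn : ∀ i, signOf w i = decide (f (absPerm w i) % 2 = 1) := by
      intro i
      rw [hf]
      have := h3 i
      cases h : signOf w i
      · simp
      · have := this h
        simp; omega
    have hhalf : ∀ i, (f (absPerm w i) + 1) / 2 = b i := by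
      intro i
      rw [hf]
      have := h3 i
      split_ifs with h
      · have := this h; omega
      · omega
    refine ⟨f, (hS f).2 ⟨fun j => ?_, hsgn, ?_⟩, funext hhalf⟩
    · have := h1 ((absPerm w).symm j)
      simp only [f]; omega
    · simpa only [sortKey_absPerm hsgn, hhalf] using h2

theorem ncard_signedWords_eq_sum {n : ℕ} (hn : 1 ≤ n) (r j : ℕ) :
    {f ∈ signedWords r n | excSumAux letterWeight f [] f = j}.ncard =
      ∑ w ∈ (setX n).filter (fun w => fexc w = j),
        (chainFinset n (descentIndicator w) 0 r).card := by
  classical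
  choose std hstd using exists_isStandardization (n := n)
  let T : Finset (Fin n → ℕ) := (Fintype.piFinset fun _ => Finset.range (2 * r + 1)).filter
    fun f => std f ∈ (setX n).filter fun w => fexc w = j
  have hT : {f ∈ signedWords r n | excSumAux letterWeight f [] f = j} =
      List.ofFn '' (T : Set (Fin n → ℕ)) := by
    ext L
    simp only [Set.mem_image, Finset.mem_coe, T, Finset.mem_filter, Fintype.mem_piFinset,
      Finset.mem_range, Nat.lt_succ_iff]
    constructor
    · rintro ⟨⟨rfl, h2, h3⟩, h4⟩
      refine ⟨fun i => L[i], ⟨fun i => h2 _ (by simp), ?_⟩, by simp⟩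
      have h5 : List.ofFn (fun i : Fin L.length => L[i]) = L := by simp
      rw [← even_iff_mem_setX (hstd _) hn, ← excSum_eq_fexc (hstd _), h5]
      exact ⟨h3, h4⟩
    · rintro ⟨f, ⟨h1, h2⟩, rfl⟩
      rw [← even_iff_mem_setX (hstd _) hn, ← excSum_eq_fexc (hstd _)] at h2
      refine ⟨⟨by simp, fun z hz => ?_, h2.1⟩, h2.2⟩
      obtain ⟨i, rfl⟩ := List.mem_ofFn.1 hz
      exact h1 i
  rw [hT, (List.ofFn_injective.injOn).ncard_image, Set.ncard_coe_finset,
    Finset.card_eq_sum_card_fiberwise (f := std) (t := (setX n).filter fun w => fexc w = j)]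
  · refine Finset.sum_congr rfl fun w hw => card_standardization_fiber w r _ fun f => ?_
    simp only [T, Finset.mem_filter, Fintype.mem_piFinset, Finset.mem_range, Nat.lt_succ_iff]
    constructor
    · rintro ⟨⟨h1, -⟩, rfl⟩
      exact ⟨h1, hstd f⟩
    · rintro ⟨h1, h2⟩
      have h3 := (hstd f).unique h2
      exact ⟨⟨h1, by rw [h3]; exact Finset.mem_filter.1 hw⟩, h3⟩
  · intro f hf
    exact (Finset.mem_filter.1 (Finset.mem_coe.1 hf)).2

theorem sum_descentIndicator {n : ℕ} (w : signedPerms n) : ∑ i, descentIndicator w i = desB w :=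
  (desB_eq_sum w).symm

/-! ### Lattice points of dilates -/

/-- The point of `½ ℤⁿ` whose coordinates are the halved partial sums of a list. -/
noncomputable def pathPoint (n : ℕ) (L : List ℕ) (i : Fin n) : ℝ :=
  ((L.take ((i : ℕ) + 1)).sum : ℝ) / 2

theorem mem_smul_halfOpenHypersimplexC {n k r : ℕ} (hr : 1 ≤ r) (x : Fin n → ℝ) :
    x ∈ (r : ℝ) • halfOpenHypersimplexC n k ↔
      ((∀ i : Fin n, (i : ℕ) = 0 → 0 ≤ 2 * x i ∧ 2 * x i ≤ r) ∧
        ∀ i j : Fin n, (j : ℕ) = (i : ℕ) + 1 → 0 ≤ x j - x i ∧ x j - x i ≤ r) ∧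
      ∀ i : Fin n, (i : ℕ) + 1 = n → (if k = 1 then 0 ≤ 2 * x i else r * ((k : ℝ) - 1) < 2 * x i) ∧
        2 * x i ≤ r * (k : ℝ) := by
  have hr0 : (0 : ℝ) < r := by exact_mod_cast hr
  have h1 : ∀ a c : ℝ, (r : ℝ)⁻¹ * a ≤ c ↔ a ≤ r * c := fun a c => inv_mul_le_iff₀ hr0
  have h2 : ∀ a c : ℝ, c ≤ (r : ℝ)⁻¹ * a ↔ r * c ≤ a := fun a c => le_inv_mul_iff₀ hr0
  have h3 : ∀ a c : ℝ, c < (r : ℝ)⁻¹ * a ↔ r * c < a := fun a c => lt_inv_mul_iff₀ hr0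
  rw [Set.mem_smul_set_iff_inv_smul_mem₀ hr0.ne', halfOpenHypersimplexC]
  by_cases hk : k = 1
  · subst hk
    simp only [if_true, hypersimplexC, parallelepipedC, Set.mem_ofPred_eq, Pi.smul_apply,
      smul_eq_mul, mul_left_comm (2 : ℝ), ← mul_sub, h1, h2, mul_one, mul_zero, Nat.cast_one,
      sub_self]
  · simp only [if_neg hk, parallelepipedC, Set.mem_ofPred_eq, Pi.smul_apply,
      smul_eq_mul, mul_left_comm (2 : ℝ), ← mul_sub, h1, h2, h3, mul_one, mul_zero]

theorem pathPoint_zero {n : ℕ} {L : List ℕ} (hL : L.length = n) (i : Fin n) (hi : (i : ℕ) = 0) :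
    2 * pathPoint n L i = (L[(i : ℕ)] : ℕ) := by
  rw [pathPoint, List.sum_take_succ _ _ (by omega)]
  simp [hi]
  ring

theorem pathPoint_sub {n : ℕ} {L : List ℕ} (hL : L.length = n) (i j : Fin n)
    (hij : (j : ℕ) = (i : ℕ) + 1) :
    pathPoint n L j - pathPoint n L i = ((L[(j : ℕ)] : ℕ) : ℝ) / 2 := by
  have h : L.take (j : ℕ) = L.take ((i : ℕ) + 1) := by rw [hij]
  rw [pathPoint, pathPoint, List.sum_take_succ _ (j : ℕ) (by omega), h]
  push_cast
  ring

theorem pathPoint_last {n : ℕ} {L : List ℕ} (hL : L.length = n) (i : Fin n)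
    (hi : (i : ℕ) + 1 = n) : 2 * pathPoint n L i = (L.sum : ℕ) := by
  rw [pathPoint, hi, ← hL, List.take_length]
  ring

theorem pathPoint_mem_halfIntegerLattice (n : ℕ) (L : List ℕ) :
    pathPoint n L ∈ halfIntegerLattice n :=
  fun i => ⟨((L.take ((i : ℕ) + 1)).sum : ℕ), by rw [pathPoint, Int.cast_natCast]⟩

theorem injOn_pathPoint (n : ℕ) : Set.InjOn (pathPoint n) {L | L.length = n} := by
  intro L hL L' hL' h
  refine List.ext_getElem (hL.trans hL'.symm) fun i h1 h2 => ?_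
  have hi : i < n := hL ▸ h1
  cases i with
  | zero =>
    have e1 := pathPoint_zero hL ⟨0, hi⟩ rfl
    have e2 := pathPoint_zero hL' ⟨0, hi⟩ rfl
    rw [h] at e1
    exact_mod_cast e1.symm.trans e2
  | succ i =>
    have e1 := pathPoint_sub hL ⟨i, by omega⟩ ⟨i + 1, hi⟩ rfl
    have e2 := pathPoint_sub hL' ⟨i, by omega⟩ ⟨i + 1, hi⟩ rfl
    rw [h] at e1
    have := e1.symm.trans e2
    rw [div_left_inj' two_ne_zero] at this
    exact_mod_cast this

theorem exists_pathPoint_eq {n : ℕ} (m : Fin n → ℤ) (h0 : ∀ i : Fin n, (i : ℕ) = 0 → 0 ≤ m i)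
    (h1 : ∀ i j : Fin n, (j : ℕ) = (i : ℕ) + 1 → m i ≤ m j) :
    ∃ L : List ℕ, L.length = n ∧ ∀ i, pathPoint n L i = (m i : ℝ) / 2 := by
  cases n with
  | zero => exact ⟨[], rfl, fun i => i.elim0⟩
  | succ n =>
    -- Successive differences of the doubled coordinates, starting from 0; `toNat` loses nothing by
    -- monotonicity.
    let d : Fin (n + 1) → ℕ := Fin.cases (m 0).toNat fun i => (m i.succ - m i.castSucc).toNat
    refine ⟨List.ofFn d, by simp, fun i => ?_⟩
    have key : (((List.ofFn d).take ((i : ℕ) + 1)).sum : ℤ) = m i := by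
      induction i using Fin.induction with
      | zero =>
        rw [List.sum_take_succ _ _ (by simp)]
        have := h0 0 rfl
        simp [d]
        omega
      | succ i ih =>
        have h2 := h1 i.castSucc i.succ (by simp)
        have h3 : (List.ofFn d)[(i.succ : ℕ)]'(by simp) = (m i.succ - m i.castSucc).toNat := by
          rw [List.getElem_ofFn]
          rfl
        rw [List.sum_take_succ _ _ (by simp), h3, Nat.cast_add]
        have h4 : ((i.succ : Fin (n + 1)) : ℕ) = (i.castSucc : ℕ) + 1 := by simp
        rw [h4, ih]
        omega
    rw [pathPoint, ← key, Int.cast_natCast]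

theorem smul_inter_halfIntegerLattice {n k r : ℕ} (hn : 1 ≤ n) (hr : 1 ≤ r) (hk : 1 ≤ k) :
    ((r : ℝ) • halfOpenHypersimplexC n k) ∩ (halfIntegerLattice n : Set (Fin n → ℝ)) =
      pathPoint n '' {d ∈ incrementLists r n | (k ≠ 1 → (k - 1) * r < d.sum) ∧ d.sum ≤ k * r} := by
  have hcast : ((k - 1 : ℕ) : ℝ) = (k : ℝ) - 1 := by rw [Nat.cast_sub hk, Nat.cast_one]
  have hlast : ∀ L : List ℕ, L.length = n →
      ((∀ i : Fin n, (i : ℕ) + 1 = n → (if k = 1 then 0 ≤ 2 * pathPoint n L i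
        else r * ((k : ℝ) - 1) < 2 * pathPoint n L i) ∧ 2 * pathPoint n L i ≤ r * (k : ℝ)) ↔
        (k ≠ 1 → (k - 1) * r < L.sum) ∧ L.sum ≤ k * r) := by
    intro L hL
    have h1 : (∀ i : Fin n, (i : ℕ) + 1 = n → (if k = 1 then 0 ≤ 2 * pathPoint n L i
        else r * ((k : ℝ) - 1) < 2 * pathPoint n L i) ∧ 2 * pathPoint n L i ≤ r * (k : ℝ)) ↔
        (if k = 1 then (0 : ℝ) ≤ (L.sum : ℕ) else r * ((k : ℝ) - 1) < (L.sum : ℕ)) ∧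
          ((L.sum : ℕ) : ℝ) ≤ r * (k : ℝ) := by
      constructor
      · intro h
        have := h ⟨n - 1, by omega⟩ (by simp; omega)
        rwa [pathPoint_last hL _ (by simp; omega)] at this
      · intro h i hi
        rwa [pathPoint_last hL _ hi]
    rw [h1, ← hcast]
    by_cases hk1 : k = 1
    · subst hk1
      rw [if_pos rfl, Nat.cast_one, mul_one, one_mul, Nat.cast_le]
      simp only [Nat.cast_nonneg, true_and, ne_eq, not_true_eq_false, false_imp_iff]
    · simp only [ne_eq, if_false, hk1, not_false_eq_true, true_imp_iff]
      rw [mul_comm _ r, mul_comm _ r]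
      norm_cast
  ext x
  rw [Set.mem_inter_iff, mem_smul_halfOpenHypersimplexC hr]
  constructor
  · rintro ⟨⟨⟨h1, h2⟩, h3⟩, h4⟩
    choose m hm using (show ∀ i, ∃ m : ℤ, x i = (m : ℝ) / 2 from h4)
    obtain ⟨L, hL, hLm⟩ := exists_pathPoint_eq m (fun i hi => by
      have := (h1 i hi).1
      rw [hm] at this
      have : (0 : ℝ) ≤ m i := by linarith
      exact_mod_cast this) (fun i j hij => by
      have := (h2 i j hij).1
      rw [hm, hm] at this
      have : (m i : ℝ) ≤ m j := by linarith
      exact_mod_cast this)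
    obtain rfl : pathPoint n L = x := funext fun i => by rw [hLm, hm]
    have h0 : ∀ i : Fin n, (i : ℕ) = 0 → L[(i : ℕ)] ≤ r := fun i hi => by
      have := (h1 i hi).2
      rw [pathPoint_zero hL i hi] at this
      exact_mod_cast this
    refine ⟨L, ⟨⟨hL, fun z hz => ?_, fun z hz => ?_⟩, (hlast L hL).1 h3⟩, rfl⟩
    · obtain ⟨i, hi, rfl⟩ := List.getElem_of_mem hz
      cases i with
      | zero => have := h0 ⟨0, by omega⟩ rfl; simp at this; omega
      | succ i =>
        have := (h2 ⟨i, by omega⟩ ⟨i + 1, by omega⟩ rfl).2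
        rw [pathPoint_sub hL _ _ rfl, div_le_iff₀ two_pos] at this
        have : L[i + 1] ≤ r * 2 := by exact_mod_cast this
        omega
    · have := h0 ⟨0, by omega⟩ rfl
      cases L with
      | nil => simp at hz
      | cons y L => simp at hz this; omega
  · rintro ⟨L, ⟨⟨hL, h1, h2⟩, h3⟩, rfl⟩
    refine ⟨⟨⟨fun i hi => ?_, fun i j hij => ?_⟩, (hlast L hL).2 h3⟩,
      pathPoint_mem_halfIntegerLattice n L⟩
    · rw [pathPoint_zero hL i hi]
      refine ⟨Nat.cast_nonneg _, ?_⟩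
      have h4 : L[(i : ℕ)] ≤ r := by
        cases L with
        | nil => have := i.2; simp at hL; omega
        | cons y L => simpa [hi] using h2 y (by simp)
      exact_mod_cast h4
    · rw [pathPoint_sub hL i j hij]
      refine ⟨by positivity, ?_⟩
      rw [div_le_iff₀ two_pos]
      have h4 : L[(j : ℕ)] ≤ r * 2 := by
        have := h1 L[(j : ℕ)] (by simp)
        omega
      exact_mod_cast h4

theorem finite_and_ncard_smul_inter {n k r : ℕ} (hn : 1 ≤ n) (hr : 1 ≤ r) (hk : 1 ≤ k) :
    (((r : ℝ) • halfOpenHypersimplexC n k) ∩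
      (halfIntegerLattice n : Set (Fin n → ℝ))).Finite ∧
    (((r : ℝ) • halfOpenHypersimplexC n k) ∩ (halfIntegerLattice n : Set (Fin n → ℝ))).ncard =
      ∑ w ∈ (setX n).filter (fun w => fexc w = k - 1),
        (chainFinset n (descentIndicator w) 0 r).card := by
  rw [smul_inter_halfIntegerLattice hn hr hk]
  refine ⟨((finite_incrementLists r n).subset (Set.sep_subset _ _)).image _, ?_⟩
  rw [← ncard_signedWords_eq_sum hn, ncard_signedWords_eq_ncard_incrementLists hk]
  exact ((injOn_pathPoint n).mono fun L hL => hL.1.1).ncard_image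

/-! ### Dimension -/

/-- The strict inequalities cut out an open set, which is nonempty for `k < 2 * n`; a nonempty open
subset spans the whole space. -/
theorem setDim_halfOpenHypersimplexC {n k : ℕ} (hk : 1 ≤ k) (hkn : k < 2 * n) :
    setDim (halfOpenHypersimplexC n k) = n := by
  let U : Set (Fin n → ℝ) := {x | (∀ i : Fin n, (i : ℕ) = 0 → 0 < 2 * x i ∧ 2 * x i < 1) ∧
    (∀ i j : Fin n, (j : ℕ) = (i : ℕ) + 1 → 0 < x j - x i ∧ x j - x i < 1) ∧
    ∀ i : Fin n, (i : ℕ) + 1 = n → (k : ℝ) - 1 < 2 * x i ∧ 2 * x i < (k : ℝ)}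
  have hU : IsOpen U := by
    simp only [U, Set.ofPred_and, Set.ofPred_forall]
    refine IsOpen.inter ?_ (IsOpen.inter ?_ ?_)
    · exact isOpen_iInter_of_finite fun i => isOpen_iInter_of_finite fun _ =>
        (isOpen_lt (by fun_prop) (by fun_prop)).inter (isOpen_lt (by fun_prop) (by fun_prop))
    · exact isOpen_iInter_of_finite fun i => isOpen_iInter_of_finite fun j =>
        isOpen_iInter_of_finite fun _ =>
        (isOpen_lt (by fun_prop) (by fun_prop)).inter (isOpen_lt (by fun_prop) (by fun_prop))
    · exact isOpen_iInter_of_finite fun i => isOpen_iInter_of_finite fun _ =>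
        (isOpen_lt (by fun_prop) (by fun_prop)).inter (isOpen_lt (by fun_prop) (by fun_prop))
  have hne : U.Nonempty := by
    have hk' : (1 : ℝ) ≤ k := by exact_mod_cast hk
    have hkn' : (k : ℝ) + 1 ≤ 2 * n := by exact_mod_cast hkn
    have hpos : (0 : ℝ) < 2 * n - 1 := by linarith
    -- The point has first coordinate `θ / 2` and constant increments `θ`; this `θ` puts the doubled
    -- last coordinate at the midpoint of `[k - 1, k]`.
    obtain ⟨θ, hθ⟩ : ∃ θ : ℝ, θ * (2 * n - 1) = k - 1 / 2 :=
      ⟨(k - 1 / 2) / (2 * n - 1), div_mul_cancel₀ _ hpos.ne'⟩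
    have h0 : 0 < θ := by
      by_contra h
      nlinarith
    have h1 : θ < 1 := by
      by_contra h
      nlinarith
    refine ⟨fun i => θ * (2 * (i : ℕ) + 1) / 2, fun i hi => ?_, fun i j hij => ?_, fun i hi => ?_⟩
    · have h2 : ((i : ℕ) : ℝ) = 0 := by exact_mod_cast hi
      simp only [h2]
      constructor <;> linarith
    · have h2 : ((j : ℕ) : ℝ) = (i : ℕ) + 1 := by exact_mod_cast hij
      simp only [h2]
      constructor <;> linarith
    · have h2 : ((i : ℕ) : ℝ) = n - 1 := by
        rw [eq_sub_iff_add_eq]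
        exact_mod_cast hi
      have h3 : 2 * (θ * (2 * ((i : ℕ) : ℝ) + 1) / 2) = k - 1 / 2 := by
        rw [h2, ← hθ]; ring
      simp only [h3]
      constructor <;> linarith
  have hsub : U ⊆ halfOpenHypersimplexC n k := by
    rintro x ⟨h1, h2, h3⟩
    have hp : x ∈ parallelepipedC n :=
      ⟨fun i hi => ⟨(h1 i hi).1.le, (h1 i hi).2.le⟩,
        fun i j hij => ⟨(h2 i j hij).1.le, (h2 i j hij).2.le⟩⟩
    rw [halfOpenHypersimplexC]
    split_ifs with hk1
    · subst hk1
      exact ⟨hp, fun i hi => ⟨(h3 i hi).1.le, (h3 i hi).2.le⟩⟩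
    · exact ⟨hp, fun i hi => ⟨(h3 i hi).1, (h3 i hi).2.le⟩⟩
  have htop : vectorSpan ℝ (halfOpenHypersimplexC n k) = ⊤ := by
    rw [eq_top_iff, ← AffineSubspace.vectorSpan_eq_top_of_affineSpan_eq_top ℝ (Fin n → ℝ)
      (Fin n → ℝ) (hU.affineSpan_eq_top hne)]
    exact vectorSpan_mono ℝ hsub
  rw [setDim, htop, finrank_top, Module.finrank_fin_fun]

/-! ### The Ehrhart series -/

theorem card_chainFinset_pos {n : ℕ} (w : signedPerms n) :
    0 < (chainFinset n (descentIndicator w) 0 n).card := by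
  rw [Finset.card_pos]
  refine ⟨fun i => i + 1, ?_⟩
  rw [mem_chainFinset]
  intro i
  have h1 : (Fin.cons 0 (fun i : Fin n => (i : ℕ) + 1) : Fin (n + 1) → ℕ) i.castSucc = i := by
    cases n with
    | zero => exact i.elim0
    | succ n => refine Fin.cases ?_ (fun i => ?_) i <;> simp
  have h2 : descentIndicator w i ≤ 1 := by
    rw [descentIndicator]; split_ifs <;> simp
  have := i.2
  omega

/-- Count lattice points in the dilate by `n`: there each `w` would contribute at least one chain,
yet increments sum to at most `n + (n - 1) * 2n = (2n - 1) n ≤ (k - 1) n`, so there are no points.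
-/
theorem filter_setX_eq_empty {n k : ℕ} (hn : 1 ≤ n) (hk : 2 * n ≤ k) :
    (setX n).filter (fun w => fexc w = k - 1) = ∅ := by
  have h1 := (finite_and_ncard_smul_inter hn hn (show 1 ≤ k by omega)).2
  have h2 : {d ∈ incrementLists n n | (k ≠ 1 → (k - 1) * n < d.sum) ∧ d.sum ≤ k * n} = ∅ := by
    rw [Set.eq_empty_iff_forall_notMem]
    rintro L ⟨⟨h1, h2, h3⟩, h4, -⟩
    have h5 := h4 (by omega)
    cases L with
    | nil => simp at h1; omega
    | cons y L =>
      have h6 : L.sum ≤ L.length * (2 * n) := by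
        have := List.sum_le_card_nsmul L (2 * n) fun z hz => h2 z (by simp [hz])
        simpa using this
      have h7 : y ≤ n := h3 y (by simp)
      have h8 : (2 * n - 1) * n ≤ (k - 1) * n := Nat.mul_le_mul_right _ (by omega)
      obtain ⟨m, rfl⟩ : ∃ m, n = m + 1 := ⟨n - 1, by omega⟩
      simp only [List.length_cons, Nat.add_right_cancel_iff] at h1
      rw [h1] at h6
      rw [List.sum_cons] at h5
      have h9 : 2 * (m + 1) - 1 = 2 * m + 1 := by omega
      rw [h9] at h8
      nlinarith
  rw [smul_inter_halfIntegerLattice hn hn (by omega), h2, Set.image_empty, Set.ncard_empty] at h1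
  rw [Finset.eq_empty_iff_forall_notMem]
  intro w hw
  have := Finset.sum_eq_zero_iff.1 h1.symm w hw
  have := card_chainFinset_pos w
  omega

theorem desB_le {n : ℕ} (w : signedPerms n) : desB w ≤ n := by
  rw [desB_eq_sum, ← Finset.card_filter]
  exact (Finset.card_filter_le _ _).trans (by simp)

/-- The polynomial `(r - d + 1) ⋯ (r - d + n) / n!` has the roots `d - n, …, d - 1`. As `d ≤ n`,
these include every natural number below `d`, in particular `r = 0` if `d > 0`, so the Ehrhart
polynomial has the required value at 0. -/
theorem eval_preHilbertPoly_of_le {n d : ℕ} (hd : d ≤ n) (r : ℕ) :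
    (Polynomial.preHilbertPoly ℚ n d).eval (r : ℚ) =
      if d ≤ r then ((n + (r - d)).choose n : ℚ) else 0 := by
  split_ifs with h
  · rw [Polynomial.preHilbertPoly_eq_choose_sub_add ℚ n h, add_comm]
  · have h1 : (r : ℚ) - d + 1 = -((d - r - 1 : ℕ) : ℚ) := by
      rw [Nat.cast_sub (by omega), Nat.cast_sub (by omega)]; push_cast; ring
    rw [Polynomial.preHilbertPoly, Polynomial.eval_smul, Polynomial.eval_comp]
    simp only [Polynomial.eval_add, Polynomial.eval_sub, Polynomial.eval_X, Polynomial.eval_C,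
      Polynomial.eval_one]
    rw [h1, ascPochhammer_eval_neg_coe_nat_of_lt (by omega), smul_zero]

theorem eval_preHilbertPoly_desB {n : ℕ} (w : signedPerms n) (r : ℕ) :
    (Polynomial.preHilbertPoly ℚ n (desB w)).eval (r : ℚ) =
      (chainFinset n (descentIndicator w) 0 r).card := by
  rw [eval_preHilbertPoly_of_le (desB_le w)]
  have h1 := mk_card_chainFinset n (descentIndicator w)
  have h2 := PowerSeries.mk_add_choose_mul_one_sub_pow_eq_one ℚ n
  have h3 : PowerSeries.mk (fun r => ((chainFinset n (descentIndicator w) 0 r).card : ℚ)) =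
      PowerSeries.X ^ desB w * PowerSeries.mk (fun r => ((n + r).choose n : ℚ)) := by
    rw [sum_descentIndicator] at h1
    rw [← h1, mul_assoc, mul_comm (_ ^ _), h2, mul_one]
  have h4 := congrArg (PowerSeries.coeff r) h3
  rw [PowerSeries.coeff_mk, PowerSeries.coeff_X_pow_mul', PowerSeries.coeff_mk] at h4
  exact h4.symm

theorem theoremB (n k : ℕ) (hn : 1 ≤ n) (hk : 1 ≤ k) :
    IsHStarPolynomial (halfIntegerLattice n) (halfOpenHypersimplexC n k)
      (∑ w ∈ (setX n).filter (fun w => fexc w = k - 1), (Polynomial.X : Polynomial ℚ) ^ desB w) := by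
  refine ⟨∑ w ∈ (setX n).filter (fun w => fexc w = k - 1), Polynomial.preHilbertPoly ℚ n (desB w),
    fun r hr => ?_, ?_⟩
  · obtain ⟨h1, h2⟩ := finite_and_ncard_smul_inter hn hr hk
    refine ⟨h1, ?_⟩
    rw [h2, Polynomial.eval_finsetSum, Nat.cast_sum]
    exact Finset.sum_congr rfl fun w _ => eval_preHilbertPoly_desB w r
  -- For `k ≥ 2 * n` both sides vanish, so the dimension of the set plays no role.
  · rcases le_or_gt (2 * n) k with hkn | hkn
    · rw [filter_setX_eq_empty hn hkn]
      have h1 : PowerSeries.mk (fun _ : ℕ => (0 : ℚ)) = 0 := by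
        ext
        simp
      simp only [Finset.sum_empty, Polynomial.eval_zero, h1, zero_mul, Polynomial.coe_zero]
    · rw [setDim_halfOpenHypersimplexC hk hkn]
      have h1 : PowerSeries.mk (fun r : ℕ => (∑ w ∈ (setX n).filter (fun w => fexc w = k - 1),
          Polynomial.preHilbertPoly ℚ n (desB w)).eval (r : ℚ)) =
          ∑ w ∈ (setX n).filter (fun w => fexc w = k - 1),
            PowerSeries.mk fun r => ((chainFinset n (descentIndicator w) 0 r).card : ℚ) := by
        ext r
        rw [PowerSeries.coeff_mk, Polynomial.eval_finsetSum, map_sum]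
        exact Finset.sum_congr rfl fun w _ => by
          rw [eval_preHilbertPoly_desB, PowerSeries.coeff_mk]
      rw [h1, Finset.sum_mul, ← Polynomial.coeToPowerSeries.ringHom_apply, map_sum]
      refine Finset.sum_congr rfl fun w _ => ?_
      rw [mk_card_chainFinset, sum_descentIndicator]
      simp
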